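/- Let $(\Omega,\mathcal F,\mathbb P)$ be a complete probability space carrying a standard one-dimensional Brownian motion $W$, and let $\mathbb F$ be the usual augmentation of the natural filtration of $W$. Let $\mathcal U$ be the set of real-valued $\mathbb F$-progressively measurable processes $u$ on $[0,1]$ with $\mathbb E\int_0^1|u(t)|^2\,dt<\infty$. For $x\in\mathbb R$ and $u_1,u_2\in\mathcal U$ let $$X(t)=x+\int_0^t\sqrt s\,u_1(s)\,ds+\int_0^t s\,u_2(s)\,dW(s),\qquad t\in[0,1],$$ be the solution of $dX(t)=\sqrt t\,u_1(t)\,dt+t\,u_2(t)\,dW(t)$, $X(0)=x$, and let $$J(x;u_1,u_2)=\mathbb E\Big\{|X(1)|^2+\int_0^1\big[2t\,u_1(t)u_2(t)-t^2|u_2(t)|^2\big]dt\Big\}.$$ The Itô integrals exist and the random variable in braces is integrable, so that $J$ is well defined and finite. Define the open-loop upper and lower values $$V^+(x)=\inf_{u_1\in\mathcal U}\sup_{u_2\in\mathcal U}J(x;u_1,u_2),\qquad V^-(x)=\sup_{u_2\in\mathcal U}\inf_{u_1\in\mathcal U}J(x;u_1,u_2).$$ Then $V^+(x)=x^2$ and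 $V^-(x)=0$ for every $x\in\mathbb R$. In particular, for every $x\ne0$ both values are finite but $V^-(x)\ne V^+(x)$, i.e. the game has no open-loop value at $x$. -/

import Mathlib

open MeasureTheory ProbabilityTheory Filter Set
open scoped NNReal ENNReal Topology

namespace LQGame

section

variable {Ω : Type*} {mΩ : MeasurableSpace Ω} {P : Measure Ω} {W : ℝ≥0 → Ω → ℝ}

/-- The σ-algebra generated by the `P`-null sets. -/
@[reducible] def nullSigma (P : Measure Ω) : MeasurableSpace Ω :=
  MeasurableSpace.generateFrom {A | P A = 0}

theorem nullSigma_le [P.IsComplete] : nullSigma P ≤ mΩ :=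
  MeasurableSpace.generateFrom_le fun _ hA => Measure.IsComplete.out' _ hA

theorem stronglyMeasurable_brownian [P.IsComplete] (hW : IsBrownianReal W P) (t : ℝ≥0) :
    StronglyMeasurable (W t) :=
  (hW.aemeasurable t).nullMeasurable.measurable_of_complete.stronglyMeasurable

/-- The usual augmentation of the natural filtration of the Brownian motion `W`: the natural
filtration is enlarged by all `P`-null sets and then made right-continuous. -/
noncomputable def brownianFiltration [P.IsComplete] (hW : IsBrownianReal W P) :
    Filtration ℝ≥0 mΩ :=
  (Filtration.natural W (stronglyMeasurable_brownian hW) ⊔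
    Filtration.const ℝ≥0 (nullSigma P) nullSigma_le).rightCont

/-- Lebesgue measure on the time axis `[0, ∞)`. -/
noncomputable def lebesgue : Measure ℝ≥0 :=
  Measure.comap ((↑) : ℝ≥0 → ℝ) volume

/-- The squared norm `𝔼 ∫₀ᵀ |φ(t)|² dt`, as an extended nonnegative number. -/
noncomputable def energy (P : Measure Ω) (T : ℝ≥0) (φ : ℝ≥0 → Ω → ℝ) : ℝ≥0∞ :=
  ∫⁻ ω, ∫⁻ t in Icc 0 T, ‖φ t ω‖ₑ ^ 2 ∂lebesgue ∂P

/-- The space of controls on `[0, T]`: progressively measurable processes `u` with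
`𝔼 ∫₀ᵀ |u(t)|² dt < ∞`. Processes are written with time set `[0, ∞)`; only their values
on `[0, T]` are ever used (a process on `[0, T]` is extended by zero). -/
def Control [P.IsComplete] (hW : IsBrownianReal W P) (T : ℝ≥0) : Type _ :=
  {u : ℝ≥0 → Ω → ℝ //
    IsStronglyProgressive (brownianFiltration hW) u ∧ energy P T u < ∞}

/-- A simple process `∑ᵢ ξᵢ 1_{(aᵢ, bᵢ]}`, each `ξᵢ` bounded and `ℱ aᵢ`-measurable. -/
structure SimpleProcess (ℱ : Filtration ℝ≥0 mΩ) where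
  /-- number of summands -/
  n : ℕ
  /-- left end points -/
  a : Fin n → ℝ≥0
  /-- right end points -/
  b : Fin n → ℝ≥0
  /-- coefficients -/
  ξ : Fin n → Ω → ℝ
  le : ∀ i, a i ≤ b i
  measurable : ∀ i, StronglyMeasurable[ℱ (a i)] (ξ i)
  bounded : ∀ i, ∃ C : ℝ, ∀ ω, |ξ i ω| ≤ C

/-- The simple process as a function of time and sample point. -/
noncomputable def SimpleProcess.toFun {ℱ : Filtration ℝ≥0 mΩ} (φ : SimpleProcess ℱ)
    (t : ℝ≥0) (ω : Ω) : ℝ :=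
  ∑ i, (Ioc (φ.a i) (φ.b i)).indicator (fun _ => φ.ξ i ω) t

/-- The stochastic integral over `[0, T]` of a simple process. -/
def SimpleProcess.integral {ℱ : Filtration ℝ≥0 mΩ} (φ : SimpleProcess ℱ)
    (W : ℝ≥0 → Ω → ℝ) (T : ℝ≥0) (ω : Ω) : ℝ :=
  ∑ i, φ.ξ i ω * (W (min (φ.b i) T) ω - W (min (φ.a i) T) ω)

/-- `I` is (a version of) the Itô integral `∫₀ᵀ φ(t) dW(t)`: the `L²(P)`-limit of the integrals
of a sequence of simple processes that converges to `φ` in `L²([0, T] × Ω)`. -/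
def IsItoIntegral [P.IsComplete] (hW : IsBrownianReal W P) (φ : ℝ≥0 → Ω → ℝ) (T : ℝ≥0)
    (I : Ω → ℝ) : Prop :=
  MemLp I 2 P ∧ ∃ Φ : ℕ → SimpleProcess (brownianFiltration hW),
    Tendsto (fun k => energy P T (fun t ω => (Φ k).toFun t ω - φ t ω)) atTop (𝓝 0) ∧
    Tendsto (fun k => ∫⁻ ω, ‖(Φ k).integral W T ω - I ω‖ₑ ^ 2 ∂P) atTop (𝓝 0)

open Classical in
/-- The Itô integral `∫₀ᵀ φ(t) dW(t)` (defined up to `P`-null sets; `0` if it does not exist). -/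
noncomputable def itoIntegral [P.IsComplete] (hW : IsBrownianReal W P) (φ : ℝ≥0 → Ω → ℝ)
    (T : ℝ≥0) : Ω → ℝ :=
  if h : ∃ I, IsItoIntegral hW φ T I then h.choose else 0

/-- The state process of `dX(t) = √t u₁(t) dt + t u₂(t) dW(t)`, `X(0) = x`; the right-hand side
does not contain `X`, so the integrated equation gives `X` explicitly. -/
noncomputable def state [P.IsComplete] (hW : IsBrownianReal W P) (x : ℝ)
    (u₁ u₂ : Control hW 1) (t : ℝ≥0) (ω : Ω) : ℝ :=
  x + (∫ s in Icc 0 t, Real.sqrt s * u₁.1 s ω ∂lebesgue) +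
    itoIntegral hW (fun s ω => (s : ℝ) * u₂.1 s ω) t ω

/-- The random variable `|X(1)|² + ∫₀¹ [2 t u₁(t) u₂(t) - t² |u₂(t)|²] dt`. -/
noncomputable def payoff [P.IsComplete] (hW : IsBrownianReal W P) (x : ℝ)
    (u₁ u₂ : Control hW 1) (ω : Ω) : ℝ :=
  |state hW x u₁ u₂ 1 ω| ^ 2 +
    ∫ t in Icc (0 : ℝ≥0) 1,
      (2 * (t : ℝ) * u₁.1 t ω * u₂.1 t ω - (t : ℝ) ^ 2 * |u₂.1 t ω| ^ 2) ∂lebesgue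

/-- The functional `J(x; u₁, u₂)`, the loss of Player 1 and the gain of Player 2. -/
noncomputable def J [P.IsComplete] (hW : IsBrownianReal W P) (x : ℝ)
    (u₁ u₂ : Control hW 1) : ℝ :=
  ∫ ω, payoff hW x u₁ u₂ ω ∂P

/-- The open-loop lower value `V⁻(x) = sup_{u₂} inf_{u₁} J(x; u₁, u₂)`. -/
noncomputable def lowerValue [P.IsComplete] (hW : IsBrownianReal W P) (x : ℝ) : EReal :=
  ⨆ u₂ : Control hW 1, ⨅ u₁ : Control hW 1, (J hW x u₁ u₂ : EReal)

/-- The open-loop upper value `V⁺(x) = inf_{u₁} sup_{u₂} J(x; u₁, u₂)`. -/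
noncomputable def upperValue [P.IsComplete] (hW : IsBrownianReal W P) (x : ℝ) : EReal :=
  ⨅ u₁ : Control hW 1, ⨆ u₂ : Control hW 1, (J hW x u₁ u₂ : EReal)

/-- The game has an open-loop value at `x`. -/
def HasOpenLoopValue [P.IsComplete] (hW : IsBrownianReal W P) (x : ℝ) : Prop :=
  lowerValue hW x = upperValue hW x

end

end LQGame

/-! Write `A = ∫₀¹ √s u₁ ds` for the drift and `M = ∫₀¹ s u₂ dW` for the noise. By the Itô isometry
`𝔼 M² = 𝔼 ∫ t² u₂² dt`, which is exactly the running penalty on `u₂`, and `𝔼 M = 0`. Hence (`J_eq`)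
`J = 𝔼 (x + A)² + 2 𝔼[A M] + 2 𝔼 ∫ t u₁ u₂ dt`, which is affine in `u₂`.

Upper value. The choice `u₁ = 0` gives `x²` against every `u₂`. If `u₁` has squared norm `N > 0`,
Player 2 answers with `c u₁ / t` on `[δ, 1]`. With `h = 𝔼 ∫_δ^1 u₁²`, the last term is `2 c h`,
while Cauchy-Schwarz and `𝔼 A² ≤ N / 2` (as `∫₀¹ s ds = 1/2`) bound `2 𝔼[A M]` below by `-2 c √(N h
/ 2)`. For small `δ` one has `h > N / 2`, so the sum is a positive multiple of `c` and exceeds any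
level (`J_response_ge`, `exists_le_J`).

Lower value. The choice `u₂ = 0` leaves `𝔼 (x + A)² ≥ 0`. Against a fixed `u₂`, Player 1 uses the
deterministic control `-(x / n) t^(-3/2)` on `[exp (-n), 1]`. Its drift is exactly `-x`, since `∫ dt
/ t = n` there, so the first two terms vanish; but `t u₁` has squared norm `x² / n`, so the last
term tends to `0` (`tendsto_J_cancel`).

The rest builds the Itô integral: isometry for simple processes over the right-continuous
augmentation, density of simple processes, and completeness of `L²`. -/

namespace LQGame

/-! ### Lebesgue measure on the half-line. -/

section Time

theorem measurableEmbedding_coe : MeasurableEmbedding ((↑) : ℝ≥0 → ℝ) :=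
  MeasurableEmbedding.subtype_coe measurableSet_Ici

theorem lebesgue_apply (s : Set ℝ≥0) : lebesgue s = volume (((↑) : ℝ≥0 → ℝ) '' s) :=
  measurableEmbedding_coe.comap_apply _ _

theorem map_coe_lebesgue : lebesgue.map ((↑) : ℝ≥0 → ℝ) = volume.restrict (Ici 0) := by
  rw [lebesgue, measurableEmbedding_coe.map_comap]
  congr 1
  exact NNReal.range_coe

theorem lebesgue_Ioc (a b : ℝ≥0) : lebesgue (Ioc a b) = ENNReal.ofReal ((b : ℝ) - a) := by
  rw [lebesgue_apply, NNReal.image_coe_Ioc, Real.volume_Ioc]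

theorem lebesgue_Icc (a b : ℝ≥0) : lebesgue (Icc a b) = ENNReal.ofReal ((b : ℝ) - a) := by
  rw [lebesgue_apply, NNReal.image_coe_Icc, Real.volume_Icc]

/-- Lebesgue measure on the time interval `[0, T]`. -/
noncomputable abbrev timeMeasure (T : ℝ≥0) : Measure ℝ≥0 := lebesgue.restrict (Icc 0 T)

instance (a b : ℝ≥0) : IsFiniteMeasure (lebesgue.restrict (Icc a b)) :=
  ⟨by rw [Measure.restrict_apply_univ, lebesgue_Icc]; exact ENNReal.ofReal_lt_top⟩

theorem timeMeasure_mono {s t : ℝ≥0} (h : s ≤ t) : timeMeasure s ≤ timeMeasure t :=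
  Measure.restrict_mono (Icc_subset_Icc le_rfl h) le_rfl

theorem setIntegral_lebesgue_Icc (f : ℝ → ℝ) (a b : ℝ≥0) :
    ∫ t in Icc a b, f t ∂lebesgue = ∫ t in Icc (a : ℝ) b, f t := by
  have h : lebesgue.restrict (Icc a b) = lebesgue.restrict (((↑) : ℝ≥0 → ℝ) ⁻¹' Icc (a : ℝ) b) := by
    congr 1
  rw [h, ← measurableEmbedding_coe.setIntegral_map, map_coe_lebesgue,
    Measure.restrict_restrict measurableSet_Icc,
    inter_eq_self_of_subset_left (t := Ici 0) (fun t ht => mem_Ici.2 (a.coe_nonneg.trans ht.1))]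

theorem integral_timeMeasure (f : ℝ → ℝ) (T : ℝ≥0) :
    ∫ t, f t ∂timeMeasure T = ∫ t in (0 : ℝ)..T, f t := by
  rw [setIntegral_lebesgue_Icc, NNReal.coe_zero, integral_Icc_eq_integral_Ioc,
    intervalIntegral.integral_of_le T.coe_nonneg]

theorem ae_lebesgue_of_ae_volume {p : ℝ → Prop} (h : ∀ᵐ y : ℝ, p y) :
    ∀ᵐ t : ℝ≥0 ∂lebesgue, p (t : ℝ) := by
  refine ae_of_ae_map measurableEmbedding_coe.measurable.aemeasurable ?_
  rw [map_coe_lebesgue]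
  exact ae_restrict_of_ae h

theorem ae_timeMeasure_le (T : ℝ≥0) : ∀ᵐ t ∂timeMeasure T, t ≤ T := by
  filter_upwards [ae_restrict_mem measurableSet_Icc] with t ht using ht.2

end Time

/-! ### Square-integrable functions: Cauchy-Schwarz and forms of the squared norm. -/

section CauchySchwarz

variable {α : Type*} {mα : MeasurableSpace α} {μ : Measure α}

theorem integrable_fun_mul {f g : α → ℝ} (hf : MemLp f 2 μ) (hg : MemLp g 2 μ) :
    Integrable (fun a => f a * g a) μ :=
  hf.integrable_mul hg

/-- The quadratic `c ↦ ∫ (f + c g)²` is nonnegative, so its discriminant is at most zero. -/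
theorem sq_integral_mul_le {f g : α → ℝ} (hf : MemLp f 2 μ) (hg : MemLp g 2 μ) :
    (∫ a, f a * g a ∂μ) ^ 2 ≤ (∫ a, f a ^ 2 ∂μ) * ∫ a, g a ^ 2 ∂μ := by
  have hff := hf.integrable_sq
  have hgg := hg.integrable_sq
  have hfg : Integrable (fun a => f a * g a) μ := integrable_fun_mul hf hg
  have key : ∀ c : ℝ, 0 ≤ (∫ a, g a ^ 2 ∂μ) * (c * c) + (2 * ∫ a, f a * g a ∂μ) * c
      + ∫ a, f a ^ 2 ∂μ := by
    intro c
    have h : ∫ a, (f a + c * g a) ^ 2 ∂μ = (∫ a, g a ^ 2 ∂μ) * (c * c)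
        + (2 * ∫ a, f a * g a ∂μ) * c + ∫ a, f a ^ 2 ∂μ := by
      have e : (fun a => (f a + c * g a) ^ 2)
          = fun a => f a ^ 2 + ((c * c) * g a ^ 2 + (2 * c) * (f a * g a)) := by
        ext a; ring
      have hi : Integrable (fun a => (c * c) * g a ^ 2 + (2 * c) * (f a * g a)) μ :=
        (hgg.const_mul _).add (hfg.const_mul _)
      rw [e, integral_add hff hi,
        integral_add (hgg.const_mul _) (hfg.const_mul _), integral_const_mul, integral_const_mul]
      ring
    rw [← h]
    exact integral_nonneg fun a => sq_nonneg _
  have := discrim_le_zero key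
  rw [discrim] at this
  nlinarith

theorem memLp_mul_of_bounded {f g : α → ℝ} (hf : AEStronglyMeasurable f μ) {C : ℝ}
    (hC : ∀ a, |f a| ≤ C) {p : ℝ≥0∞} (hg : MemLp g p μ) : MemLp (fun a => f a * g a) p μ :=
  MemLp.of_le_mul (c := C) hg (hf.mul hg.1) (ae_of_all _ fun a => by
    rw [norm_mul]; exact mul_le_mul_of_nonneg_right (hC a) (norm_nonneg _))

theorem lintegral_enorm_sq_eq_eLpNorm_sq (f : α → ℝ) :
    ∫⁻ a, ‖f a‖ₑ ^ 2 ∂μ = eLpNorm f 2 μ ^ 2 := by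
  have h := eLpNorm_nnreal_pow_eq_lintegral (f := f) (μ := μ) (p := 2) two_ne_zero
  simp only [NNReal.coe_ofNat, ENNReal.rpow_ofNat, ENNReal.coe_ofNat] at h
  exact h.symm

theorem lintegral_enorm_sq_eq_ofReal {f : α → ℝ} (hf : MemLp f 2 μ) :
    ∫⁻ a, ‖f a‖ₑ ^ 2 ∂μ = ENNReal.ofReal (∫ a, f a ^ 2 ∂μ) := by
  rw [ofReal_integral_eq_lintegral_ofReal hf.integrable_sq (ae_of_all _ fun a => sq_nonneg _)]
  refine lintegral_congr fun a => ?_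
  rw [← enorm_pow, Real.enorm_of_nonneg (sq_nonneg _)]

theorem tendsto_eLpNorm_of_tendsto_lintegral {ι : Type*} {l : Filter ι} {f : ι → α → ℝ}
    (h : Tendsto (fun i => ∫⁻ a, ‖f i a‖ₑ ^ 2 ∂μ) l (𝓝 0)) :
    Tendsto (fun i => eLpNorm (f i) 2 μ) l (𝓝 0) := by
  simp_rw [lintegral_enorm_sq_eq_eLpNorm_sq] at h
  have h' := h.ennrpow_const (1 / 2)
  rw [ENNReal.zero_rpow_of_pos (by norm_num)] at h'
  refine h'.congr fun i => ?_
  rw [← ENNReal.rpow_ofNat, ← ENNReal.rpow_mul]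
  norm_num

theorem tendsto_lintegral_of_tendsto_eLpNorm {ι : Type*} {l : Filter ι} {f : ι → α → ℝ}
    (h : Tendsto (fun i => eLpNorm (f i) 2 μ) l (𝓝 0)) :
    Tendsto (fun i => ∫⁻ a, ‖f i a‖ₑ ^ 2 ∂μ) l (𝓝 0) := by
  simp_rw [lintegral_enorm_sq_eq_eLpNorm_sq]
  have h' := h.ennrpow_const 2
  rw [ENNReal.zero_rpow_of_pos (by norm_num)] at h'
  exact h'.congr fun i => ENNReal.rpow_ofNat _ _

end CauchySchwarz

/-! ### Processes as functions on `Ω × [0, T]`. -/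

section Energy

variable {Ω : Type*} {mΩ : MeasurableSpace Ω} {P : Measure Ω}

/-- The measure `P ⊗ dt` on `Ω × [0, T]`. -/
noncomputable abbrev spaceTime (P : Measure Ω) (T : ℝ≥0) : Measure (Ω × ℝ≥0) :=
  P.prod (timeMeasure T)

theorem spaceTime_mono {s t : ℝ≥0} (h : s ≤ t) : spaceTime P s ≤ spaceTime P t :=
  Measure.prod_mono le_rfl (timeMeasure_mono h)

theorem ae_spaceTime_le (T : ℝ≥0) : ∀ᵐ p ∂spaceTime P T, p.2 ≤ T :=
  Measure.quasiMeasurePreserving_snd.ae (ae_timeMeasure_le T)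

/-- A process as a function on the product space. -/
abbrev onProd (φ : ℝ≥0 → Ω → ℝ) (p : Ω × ℝ≥0) : ℝ := φ p.2 p.1

theorem energy_eq {φ : ℝ≥0 → Ω → ℝ} {T : ℝ≥0}
    (hφ : AEStronglyMeasurable (onProd φ) (spaceTime P T)) :
    energy P T φ = ∫⁻ p, ‖onProd φ p‖ₑ ^ 2 ∂spaceTime P T := by
  rw [lintegral_prod _ (hφ.enorm.pow_const 2), energy]

theorem memLp_onProd {φ : ℝ≥0 → Ω → ℝ} {T : ℝ≥0}
    (hφ : AEStronglyMeasurable (onProd φ) (spaceTime P T)) (h : energy P T φ < ∞) :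
    MemLp (onProd φ) 2 (spaceTime P T) := by
  refine ⟨hφ, ?_⟩
  rw [energy_eq hφ, lintegral_enorm_sq_eq_eLpNorm_sq] at h
  by_contra hn
  rw [not_lt_top_iff] at hn
  simp [hn] at h

theorem energy_lt_top {φ : ℝ≥0 → Ω → ℝ} {T : ℝ≥0} (hφ : MemLp (onProd φ) 2 (spaceTime P T)) :
    energy P T φ < ∞ := by
  rw [energy_eq hφ.1, lintegral_enorm_sq_eq_eLpNorm_sq]
  exact ENNReal.pow_lt_top hφ.2

/-- Time is frozen at `min t T` and the result cut off after `T`. Keeping `m` arbitrary allows `m =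
ℱ T`, which later yields adapted time averages. -/
theorem stronglyMeasurable_stopped {m : MeasurableSpace Ω} {φ : ℝ≥0 → Ω → ℝ} {T : ℝ≥0}
    (hφ : StronglyMeasurable fun p : Iic T × Ω => φ p.1 p.2) :
    StronglyMeasurable (fun p : Ω × ℝ≥0 => if p.2 ≤ T then φ p.2 p.1 else 0) := by
  have hs : MeasurableSet {p : Ω × ℝ≥0 | p.2 ≤ T} := measurableSet_le measurable_snd measurable_const
  have hg : Measurable (fun p : Ω × ℝ≥0 =>
      ((⟨min p.2 T, mem_Iic.2 (min_le_right _ _)⟩, p.1) : Iic T × Ω)) :=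
    Measurable.prodMk (Measurable.subtype_mk (measurable_snd.min measurable_const)) measurable_fst
  have h1 : StronglyMeasurable (fun p : Ω × ℝ≥0 => φ (min p.2 T) p.1) := hφ.comp_measurable hg
  have h2 := h1.indicator hs
  have e : (fun p : Ω × ℝ≥0 => if p.2 ≤ T then φ p.2 p.1 else 0)
      = indicator {p : Ω × ℝ≥0 | p.2 ≤ T} (fun p => φ (min p.2 T) p.1) := by
    ext p
    by_cases h : p.2 ≤ T <;> simp [indicator, h]
  rw [e]
  exact h2

theorem aestronglyMeasurable_onProd {ℱ : Filtration ℝ≥0 mΩ} {φ : ℝ≥0 → Ω → ℝ}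
    (hφ : IsStronglyProgressive ℱ φ) (T : ℝ≥0) :
    AEStronglyMeasurable (onProd φ) (spaceTime P T) := by
  refine ⟨_, (stronglyMeasurable_stopped (hφ T)).mono
    (sup_le_sup (MeasurableSpace.comap_mono (ℱ.le T)) le_rfl), ?_⟩
  filter_upwards [ae_spaceTime_le T] with p hp
  simp [hp]

/-- Dominated convergence, time `0` being null. It ensures that cutting `u₁ / t` off near `0` loses
little of the norm of `u₁`. -/
theorem tendsto_integral_cut {f : Ω × ℝ≥0 → ℝ} (hf : Integrable f (spaceTime P 1)) :
    Tendsto (fun n : ℕ => ∫ p, (Ici ((n : ℝ≥0) + 1)⁻¹).indicator 1 p.2 * f p ∂spaceTime P 1)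
      atTop (𝓝 (∫ p, f p ∂spaceTime P 1)) := by
  have h1 : ∀ᵐ t ∂timeMeasure 1, t ≠ 0 := by
    filter_upwards [ae_restrict_of_ae
      (ae_lebesgue_of_ae_volume (Measure.ae_ne volume (0 : ℝ)))] with t ht
    exact fun h => ht (by simp [h])
  have h0 : ∀ᵐ p ∂spaceTime P 1, p.2 ≠ 0 := Measure.quasiMeasurePreserving_snd.ae h1
  refine tendsto_integral_of_dominated_convergence (fun p => ‖f p‖) (fun n => ?_) hf.norm
    (fun n => ae_of_all _ fun p => ?_) ?_
  · have hm : Measurable ((Ici ((n : ℝ≥0) + 1)⁻¹).indicator (1 : ℝ≥0 → ℝ)) :=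
      measurable_one.indicator measurableSet_Ici
    exact (hm.comp measurable_snd).aestronglyMeasurable.mul hf.1
  · by_cases h : p.2 ∈ Ici ((n : ℝ≥0) + 1)⁻¹
    · simp [indicator_of_mem h]
    · simp [indicator_of_notMem h]
  · filter_upwards [h0] with p hp
    refine tendsto_const_nhds.congr' ?_
    obtain ⟨N, hN⟩ := exists_nat_ge (p.2⁻¹)
    filter_upwards [eventually_ge_atTop N] with n hn
    have h : p.2 ∈ Ici ((n : ℝ≥0) + 1)⁻¹ := by
      refine mem_Ici.2 (inv_le_of_inv_le₀ (pos_of_ne_zero hp) (hN.trans ?_))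
      exact_mod_cast hn.trans (Nat.le_succ n)
    simp [indicator_of_mem h]

end Energy

/-! ### Brownian increments against the augmented, right-continuous filtration. -/

section Increments

variable {Ω : Type*} {mΩ : MeasurableSpace Ω} {P : Measure Ω} {W : ℝ≥0 → Ω → ℝ}

theorem memLp_brownian (hW : IsBrownianReal W P) (t : ℝ≥0) : MemLp (W t) 2 P :=
  (hW.isGaussianProcess.hasGaussianLaw_eval t).memLp_two

theorem memLp_increment (hW : IsBrownianReal W P) (a b : ℝ≥0) :
    MemLp (fun ω => W b ω - W a ω) 2 P :=
  (memLp_brownian hW b).sub (memLp_brownian hW a)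

theorem integral_increment (hW : IsBrownianReal W P) (a b : ℝ≥0) :
    ∫ ω, (W b ω - W a ω) ∂P = 0 := by
  rw [integral_sub (hW.integrable_eval b) (hW.integrable_eval a), hW.integral_eval,
    hW.integral_eval, sub_zero]

theorem integral_increment_sq (hW : IsBrownianReal W P) {a b : ℝ≥0} (h : a ≤ b) :
    ∫ ω, (W b ω - W a ω) ^ 2 ∂P = b - a := by
  have h1 := (hW.hasLaw_sub b a).variance_eq
  rw [variance_id_gaussianReal, variance_of_integral_eq_zero] at h1
  · simp only [Pi.sub_apply] at h1
    rw [h1, coe_nndist, NNReal.val_eq_coe, NNReal.val_eq_coe, Real.dist_eq,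
      abs_of_nonneg (sub_nonneg.2 (NNReal.coe_le_coe.2 h))]
  · exact (memLp_increment hW a b).1.aemeasurable
  · exact integral_increment hW a b

variable [P.IsComplete]

/-- The natural filtration of `W` enlarged by the null sets. -/
noncomputable def augmentedFiltration (hW : IsBrownianReal W P) : Filtration ℝ≥0 mΩ :=
  Filtration.natural W (stronglyMeasurable_brownian hW) ⊔
    Filtration.const ℝ≥0 (nullSigma P) nullSigma_le

theorem augmentedFiltration_le (hW : IsBrownianReal W P) (t : ℝ≥0) :
    augmentedFiltration hW t ≤ brownianFiltration hW t :=
  Filtration.le_rightCont _ _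

theorem brownianFiltration_le (hW : IsBrownianReal W P) {a c : ℝ≥0} (h : a < c) :
    brownianFiltration hW a ≤ augmentedFiltration hW c := by
  rw [brownianFiltration, Filtration.rightCont_eq]
  exact iInf₂_le c h

theorem stronglyMeasurable_augmented (hW : IsBrownianReal W P) (t : ℝ≥0) :
    StronglyMeasurable[augmentedFiltration hW t] (W t) := by
  have h := (Filtration.stronglyAdapted_natural (stronglyMeasurable_brownian hW)) t
  exact h.mono le_sup_left

theorem stronglyMeasurable_brownianFiltration (hW : IsBrownianReal W P) {s t : ℝ≥0} (h : s ≤ t) :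
    StronglyMeasurable[brownianFiltration hW t] (W s) :=
  ((stronglyMeasurable_augmented hW s).mono (augmentedFiltration_le hW s)).mono
    ((brownianFiltration hW).mono h)

/-- Adding null sets changes events only up to null sets, so independence passes from the natural
filtration to the enlarged one. -/
theorem augmentedFiltration_le_eventually (hW : IsBrownianReal W P) (c : ℝ≥0) :
    augmentedFiltration hW c ≤ eventuallyMeasurableSpace
      (Filtration.natural W (stronglyMeasurable_brownian hW) c) (ae P) := by
  refine sup_le le_eventuallyMeasurableSpace (MeasurableSpace.generateFrom_le fun A hA => ?_)
  exact ⟨∅, @MeasurableSet.empty _ (_), ae_eq_empty.2 hA⟩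

theorem indep_increment (hW : IsBrownianReal W P) {b c : ℝ≥0} (h : c ≤ b) :
    Indep (augmentedFiltration hW c)
      (MeasurableSpace.comap (fun ω => W b ω - W c ω) inferInstance) P := by
  rw [Indep_iff]
  intro s t hs ht
  obtain ⟨s', hs', hss⟩ := augmentedFiltration_le_eventually hW c s hs
  have h1 := (hW.indepFun_shift c).symm
  rw [IndepFun_iff_Indep, ← Filtration.natural_eq_comap _ (stronglyMeasurable_brownian hW),
    Indep_iff] at h1
  have ht' : MeasurableSet[MeasurableSpace.comap (fun ω (u : ℝ≥0) => W (c + u) ω - W c ω)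
      inferInstance] t := by
    obtain ⟨A, hA, rfl⟩ := ht
    refine ⟨(fun f : ℝ≥0 → ℝ => f (b - c)) ⁻¹' A, (measurable_pi_apply _) hA, ?_⟩
    ext ω
    simp [add_tsub_cancel_of_le h]
  rw [measure_congr (hss.inter (ae_eq_refl t)), measure_congr hss]
  exact h1 s' t hs' ht'

theorem indepFun_increment (hW : IsBrownianReal W P) {b c : ℝ≥0} (h : c ≤ b) {X : Ω → ℝ}
    (hX : StronglyMeasurable[augmentedFiltration hW c] X) :
    IndepFun X (fun ω => W b ω - W c ω) P := by
  rw [IndepFun_iff_Indep]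
  exact indep_of_indep_of_le_left (indep_increment hW h) hX.measurable.comap_le

theorem integral_mul_increment_of_augmented (hW : IsBrownianReal W P) {b c : ℝ≥0} (h : c ≤ b)
    {X : Ω → ℝ} (hX : StronglyMeasurable[augmentedFiltration hW c] X) :
    ∫ ω, X ω * (W b ω - W c ω) ∂P = 0 := by
  rw [(indepFun_increment hW h hX).integral_fun_mul_eq_mul_integral
    (hX.mono ((augmentedFiltration hW).le c)).aestronglyMeasurable (memLp_increment hW c b).1,
    integral_increment hW, mul_zero]

theorem integral_mul_increment_sq_of_augmented (hW : IsBrownianReal W P) {b c : ℝ≥0} (h : c ≤ b)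
    {X : Ω → ℝ} (hX : StronglyMeasurable[augmentedFiltration hW c] X) :
    ∫ ω, X ω * (W b ω - W c ω) ^ 2 ∂P = (b - c) * ∫ ω, X ω ∂P := by
  have hi : IndepFun X (fun ω => (W b ω - W c ω) ^ 2) P :=
    (indepFun_increment hW h hX).comp measurable_id (measurable_id.pow_const 2)
  rw [hi.integral_fun_mul_eq_mul_integral
    (hX.mono ((augmentedFiltration hW).le c)).aestronglyMeasurable
    ((memLp_increment hW c b).1.pow 2), integral_increment_sq hW h, mul_comm]

/-- `X` is only measurable for the right limit at `a`, so independence is available from each `c >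
a` onward. The increment over `[c, b]` contributes nothing, the one over `[a, c]` at most `(𝔼 X² (c
- a))^(1/2)`; then `c ↓ a`. -/
theorem integral_mul_increment (hW : IsBrownianReal W P) {a b : ℝ≥0} (h : a ≤ b)
    {X : Ω → ℝ} (hX : StronglyMeasurable[brownianFiltration hW a] X) (hX2 : MemLp X 2 P) :
    ∫ ω, X ω * (W b ω - W a ω) ∂P = 0 := by
  rcases h.eq_or_lt with rfl | hab
  · simp
  have key : ∀ c : ℝ≥0, a < c → c ≤ b →
      (∫ ω, X ω * (W b ω - W a ω) ∂P) ^ 2 ≤ (∫ ω, X ω ^ 2 ∂P) * (c - a) := by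
    intro c hac hcb
    have e : ∫ ω, X ω * (W b ω - W a ω) ∂P = ∫ ω, X ω * (W c ω - W a ω) ∂P := by
      rw [← sub_eq_zero, ← integral_sub (integrable_fun_mul hX2 (memLp_increment hW a b))
        (integrable_fun_mul hX2 (memLp_increment hW a c)),
        ← integral_mul_increment_of_augmented hW hcb (hX.mono (brownianFiltration_le hW hac))]
      congr 1; ext ω; ring
    rw [e, ← integral_increment_sq hW hac.le]
    exact sq_integral_mul_le hX2 (memLp_increment hW a c)
  have hlim : Tendsto (fun c : ℝ≥0 => (∫ ω, X ω ^ 2 ∂P) * ((c : ℝ) - a)) (𝓝[>] a) (𝓝 0) := by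
    have : Tendsto (fun c : ℝ≥0 => (∫ ω, X ω ^ 2 ∂P) * ((c : ℝ) - a)) (𝓝 a)
        (𝓝 ((∫ ω, X ω ^ 2 ∂P) * ((a : ℝ) - a))) :=
      (Continuous.tendsto (by fun_prop) a)
    rw [sub_self, mul_zero] at this
    exact this.mono_left nhdsWithin_le_nhds
  have hle := ge_of_tendsto hlim (by
    filter_upwards [Ioc_mem_nhdsGT hab] with c hc using key c hc.1 hc.2)
  exact pow_eq_zero_iff two_ne_zero |>.1 (le_antisymm hle (sq_nonneg _))

/-- Same passage `c ↓ a`: split the increment at `c`; the cross term vanishes and the square over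
`[a, c]` costs at most `C (c - a)`. -/
theorem integral_mul_increment_sq (hW : IsBrownianReal W P) {a b : ℝ≥0} (h : a ≤ b)
    {X : Ω → ℝ} (hX : StronglyMeasurable[brownianFiltration hW a] X) {C : ℝ}
    (hC : ∀ ω, |X ω| ≤ C) :
    ∫ ω, X ω * (W b ω - W a ω) ^ 2 ∂P = (b - a) * ∫ ω, X ω ∂P := by
  rcases h.eq_or_lt with rfl | hab
  · simp
  have hXm : AEStronglyMeasurable X P :=
    (hX.mono ((brownianFiltration hW).le a)).aestronglyMeasurable
  have hint : ∀ Y : Ω → ℝ, Integrable Y P → Integrable (fun ω => X ω * Y ω) P := fun Y hY =>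
    hY.bdd_mul hXm (ae_of_all _ hC)
  have key : ∀ c : ℝ≥0, a < c → c ≤ b →
      |∫ ω, X ω * (W b ω - W a ω) ^ 2 ∂P - (b - c) * ∫ ω, X ω ∂P| ≤ C * (c - a) := by
    intro c hac hcb
    have hXc := hX.mono (brownianFiltration_le hW hac)
    have hY : StronglyMeasurable[augmentedFiltration hW c] (fun ω => X ω * (W c ω - W a ω)) := by
      refine hXc.mul ((stronglyMeasurable_augmented hW c).sub ?_)
      exact (stronglyMeasurable_augmented hW a).mono ((augmentedFiltration hW).mono hac.le)
    have h1 := hint _ (memLp_increment hW c b).integrable_sq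
    have h3 := hint _ (memLp_increment hW a c).integrable_sq
    have h2 := hint _ (integrable_fun_mul (memLp_increment hW a c) (memLp_increment hW c b))
    have e : ∫ ω, X ω * (W b ω - W a ω) ^ 2 ∂P = ∫ ω, X ω * (W b ω - W c ω) ^ 2 ∂P
        + (2 * ∫ ω, (X ω * (W c ω - W a ω)) * (W b ω - W c ω) ∂P
          + ∫ ω, X ω * (W c ω - W a ω) ^ 2 ∂P) := by
      have h2' : Integrable (fun ω => 2 * ((X ω * (W c ω - W a ω)) * (W b ω - W c ω))) P := by
        refine (h2.const_mul 2).congr (ae_of_all _ fun ω => ?_)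
        ring
      rw [← integral_const_mul, ← integral_add h2' h3, ← integral_add h1 (by exact h2'.add h3)]
      congr 1; ext ω; ring
    rw [e, integral_mul_increment_sq_of_augmented hW hcb hXc,
      integral_mul_increment_of_augmented hW hcb hY, mul_zero, zero_add, add_sub_cancel_left,
      ← integral_increment_sq hW hac.le, ← integral_const_mul]
    refine (abs_integral_le_integral_abs).trans (integral_mono h3.abs
      ((memLp_increment hW a c).integrable_sq.const_mul C) fun ω => ?_)
    simp only [abs_mul, abs_pow, sq_abs]
    exact mul_le_mul_of_nonneg_right (hC ω) (sq_nonneg _)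
  have t1 : Tendsto (fun c : ℝ≥0 => C * ((c : ℝ) - a)) (𝓝[>] a) (𝓝 (C * ((a : ℝ) - a))) :=
    (Continuous.tendsto (by fun_prop) a).mono_left nhdsWithin_le_nhds
  have t2 : Tendsto (fun c : ℝ≥0 =>
      |∫ ω, X ω * (W b ω - W a ω) ^ 2 ∂P - ((b : ℝ) - c) * ∫ ω, X ω ∂P|) (𝓝[>] a)
      (𝓝 |∫ ω, X ω * (W b ω - W a ω) ^ 2 ∂P - ((b : ℝ) - a) * ∫ ω, X ω ∂P|) :=
    (Continuous.tendsto (by fun_prop) a).mono_left nhdsWithin_le_nhds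
  have hle := le_of_tendsto_of_tendsto t2 t1 (by
    filter_upwards [Ioc_mem_nhdsGT hab] with c hc using key c hc.1 hc.2)
  rw [sub_self, mul_zero] at hle
  exact sub_eq_zero.1 (abs_nonpos_iff.1 hle)

end Increments

/-! ### The Itô isometry for simple processes. -/

section SimpleIntegral

variable {Ω : Type*} {mΩ : MeasurableSpace Ω} {P : Measure Ω} {W : ℝ≥0 → Ω → ℝ}
  [P.IsComplete]

/-- Here `ξ` is the product of two coefficients, known at the later start `a'`. Whatever part of the
first increment precedes `a'` is known too and pairs to zero with the second increment; on the
overlap only the square of the common increment survives. -/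
theorem integral_mul_increments_aux (hW : IsBrownianReal W P) {a b a' b' : ℝ≥0} (hab : a ≤ b)
    (hab' : a' ≤ b') (haa : a ≤ a') {ξ : Ω → ℝ}
    (hξ : StronglyMeasurable[brownianFiltration hW a'] ξ) {C : ℝ} (hC : ∀ ω, |ξ ω| ≤ C) :
    ∫ ω, ξ ω * ((W b ω - W a ω) * (W b' ω - W a' ω)) ∂P
      = max 0 (min (b : ℝ) b' - a') * ∫ ω, ξ ω ∂P := by
  have hξm : AEStronglyMeasurable ξ P :=
    (hξ.mono ((brownianFiltration hW).le a')).aestronglyMeasurable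
  have hL : ∀ s t, MemLp (fun ω => ξ ω * (W t ω - W s ω)) 2 P := fun s t =>
    memLp_mul_of_bounded hξm hC (memLp_increment hW s t)
  have hM : ∀ s t u, u ≤ s → u ≤ t → a' ≤ s → t ≤ s →
      StronglyMeasurable[brownianFiltration hW s] (fun ω => ξ ω * (W t ω - W u ω)) :=
    fun s t u hus _ has hts =>
      (hξ.mono ((brownianFiltration hW).mono has)).mul
        ((stronglyMeasurable_brownianFiltration hW hts).sub
          (stronglyMeasurable_brownianFiltration hW hus))
  have hz : ∀ s t u v, u ≤ t → a' ≤ s → t ≤ s → s ≤ v →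
      ∫ ω, (ξ ω * (W t ω - W u ω)) * (W v ω - W s ω) ∂P = 0 := fun s t u v hut has hts hsv =>
    integral_mul_increment hW hsv (hM s t u (hut.trans hts) hut has hts) (hL u t)
  rcases le_total b a' with hba | hba
  · have h0 : max 0 (min (b : ℝ) b' - a') = 0 := by
      have : min (b : ℝ) b' ≤ a' := (min_le_left _ _).trans (NNReal.coe_le_coe.2 hba)
      exact max_eq_left (by linarith)
    rw [h0, zero_mul, ← hz a' b a b' hab le_rfl hba hab']
    congr 1; ext ω; ring
  · have key : ∀ m M : ℝ≥0, a' ≤ m → m ≤ M →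
        ∫ ω, ξ ω * ((W m ω - W a' ω) * (W M ω - W a' ω)) ∂P = (m - a') * ∫ ω, ξ ω ∂P := by
      intro m M ham hmM
      rw [← integral_mul_increment_sq hW ham hξ hC, ← add_zero (∫ ω, ξ ω * _ ^ 2 ∂P),
        ← hz m m a' M ham ham le_rfl hmM, ← integral_add]
      · congr 1; ext ω; ring
      · exact (memLp_increment hW a' m).integrable_sq.bdd_mul hξm (ae_of_all _ hC)
      · exact integrable_fun_mul (hL a' m) (memLp_increment hW m M)
    have e : ∫ ω, ξ ω * ((W b ω - W a ω) * (W b' ω - W a' ω)) ∂P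
        = ∫ ω, ξ ω * ((W b ω - W a' ω) * (W b' ω - W a' ω)) ∂P := by
      rw [← add_zero (∫ ω, ξ ω * ((W b ω - W a' ω) * _) ∂P),
        ← hz a' a' a b' haa le_rfl le_rfl hab', ← integral_add]
      · congr 1; ext ω; ring
      · exact (integrable_fun_mul (memLp_increment hW a' b) (memLp_increment hW a' b')).bdd_mul
          hξm (ae_of_all _ hC)
      · exact integrable_fun_mul (hL a a') (memLp_increment hW a' b')
    rw [e]
    rcases le_total b b' with hbb | hbb
    · rw [key b b' hba hbb, min_eq_left (NNReal.coe_le_coe.2 hbb),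
        max_eq_right (sub_nonneg.2 (NNReal.coe_le_coe.2 hba))]
    · rw [min_eq_right (NNReal.coe_le_coe.2 hbb),
        max_eq_right (sub_nonneg.2 (NNReal.coe_le_coe.2 hab')), ← key b' b hab' hbb]
      congr 1; ext ω; ring

theorem integral_mul_increments (hW : IsBrownianReal W P) {a b a' b' : ℝ≥0} (hab : a ≤ b)
    (hab' : a' ≤ b') {ξ ξ' : Ω → ℝ}
    (hξ : StronglyMeasurable[brownianFiltration hW a] ξ) {C : ℝ} (hC : ∀ ω, |ξ ω| ≤ C)
    (hξ' : StronglyMeasurable[brownianFiltration hW a'] ξ') {C' : ℝ} (hC' : ∀ ω, |ξ' ω| ≤ C') :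
    ∫ ω, (ξ ω * (W b ω - W a ω)) * (ξ' ω * (W b' ω - W a' ω)) ∂P
      = max 0 (min (b : ℝ) b' - max (a : ℝ) a') * ∫ ω, ξ ω * ξ' ω ∂P := by
  have hCC : ∀ ω, |ξ ω * ξ' ω| ≤ C * C' := fun ω => by
    rw [abs_mul]
    exact mul_le_mul (hC ω) (hC' ω) (abs_nonneg _) ((abs_nonneg _).trans (hC ω))
  rcases le_total a a' with h | h
  · rw [max_eq_right (NNReal.coe_le_coe.2 h),
      ← integral_mul_increments_aux (ξ := fun ω => ξ ω * ξ' ω) hW hab hab' h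
      ((hξ.mono ((brownianFiltration hW).mono h)).mul hξ') hCC]
    congr 1; ext ω; ring
  · rw [max_eq_left (NNReal.coe_le_coe.2 h), min_comm,
      ← integral_mul_increments_aux (ξ := fun ω => ξ ω * ξ' ω) hW hab' hab h
      (hξ.mul (hξ'.mono ((brownianFiltration hW).mono h))) hCC]
    congr 1; ext ω; ring

section

variable [IsProbabilityMeasure P]

theorem integral_mul_increments_stopped (hW : IsBrownianReal W P) {a b a' b' : ℝ≥0} (hab : a ≤ b)
    (hab' : a' ≤ b') {ξ ξ' : Ω → ℝ}
    (hξ : StronglyMeasurable[brownianFiltration hW a] ξ) {C : ℝ} (hC : ∀ ω, |ξ ω| ≤ C)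
    (hξ' : StronglyMeasurable[brownianFiltration hW a'] ξ') {C' : ℝ} (hC' : ∀ ω, |ξ' ω| ≤ C')
    (T : ℝ≥0) :
    ∫ ω, (ξ ω * (W (min b T) ω - W (min a T) ω)) * (ξ' ω * (W (min b' T) ω - W (min a' T) ω)) ∂P
      = ∫ p : Ω × ℝ≥0, ((Ioc a b).indicator (fun _ => ξ p.1) p.2)
          * ((Ioc a' b').indicator (fun _ => ξ' p.1) p.2) ∂spaceTime P T := by
  have hr : ∫ p : Ω × ℝ≥0, ((Ioc a b).indicator (fun _ => ξ p.1) p.2)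
          * ((Ioc a' b').indicator (fun _ => ξ' p.1) p.2) ∂spaceTime P T
      = max 0 (min (min (b : ℝ) b') T - max (a : ℝ) a') * ∫ ω, ξ ω * ξ' ω ∂P := by
    have e : ∀ p : Ω × ℝ≥0, ((Ioc a b).indicator (fun _ => ξ p.1) p.2)
          * ((Ioc a' b').indicator (fun _ => ξ' p.1) p.2)
        = (ξ p.1 * ξ' p.1) * (Ioc a b ∩ Ioc a' b').indicator 1 p.2 := fun p => by
      by_cases h1 : p.2 ∈ Ioc a b <;> by_cases h2 : p.2 ∈ Ioc a' b' <;> simp [h1, h2, indicator]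
    have es : Ioc a b ∩ Ioc a' b' ∩ Icc 0 T = Ioc (max a a') (min (min b b') T) := by
      ext t; simp only [mem_inter_iff, mem_Ioc, mem_Icc, zero_le, true_and, max_lt_iff, le_min_iff]
      tauto
    simp_rw [e]
    rw [integral_prod_mul (fun ω => ξ ω * ξ' ω) ((Ioc a b ∩ Ioc a' b').indicator 1),
      integral_indicator_one (measurableSet_Ioc.inter measurableSet_Ioc), measureReal_def,
      Measure.restrict_apply (measurableSet_Ioc.inter measurableSet_Ioc), es, lebesgue_Ioc,
      ENNReal.toReal_ofReal', max_comm, mul_comm]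
    push_cast
    rfl
  rw [hr]
  -- If `T < a`, then `ξ` need not be measurable at time `min a T`; but the stopped increment is
  -- zero and the overlap is empty, so both sides vanish. Likewise for `a'`.
  rcases lt_or_ge T a with hTa | hTa
  · have h1 : min b T = T := min_eq_right (hTa.le.trans hab)
    have h2 : min a T = T := min_eq_right hTa.le
    have h3 : min (min (b : ℝ) b') T - max (a : ℝ) a' ≤ 0 := by
      have := min_le_right (min (b : ℝ) b') T
      have := le_max_left (a : ℝ) a'
      have := NNReal.coe_le_coe.2 hTa.le
      linarith
    rw [max_eq_left h3, h1, h2]; simp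
  rcases lt_or_ge T a' with hTa' | hTa'
  · have h1 : min b' T = T := min_eq_right (hTa'.le.trans hab')
    have h2 : min a' T = T := min_eq_right hTa'.le
    have h3 : min (min (b : ℝ) b') T - max (a : ℝ) a' ≤ 0 := by
      have := min_le_right (min (b : ℝ) b') T
      have := le_max_right (a : ℝ) a'
      have := NNReal.coe_le_coe.2 hTa'.le
      linarith
    rw [max_eq_left h3, h1, h2]; simp
  rw [min_eq_left hTa, min_eq_left hTa', integral_mul_increments hW (le_min hab hTa)
    (le_min hab' hTa') hξ hC hξ' hC']
  push_cast
  rw [min_min_min_comm, min_self]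

end

namespace SimpleProcess

variable {hW : IsBrownianReal W P} (Φ Ψ : SimpleProcess (brownianFiltration hW)) (T : ℝ≥0)

theorem aestronglyMeasurable_ξ (i : Fin Φ.n) : AEStronglyMeasurable (Φ.ξ i) P :=
  ((Φ.measurable i).mono ((brownianFiltration hW).le _)).aestronglyMeasurable

theorem stronglyMeasurable_term (i : Fin Φ.n) :
    StronglyMeasurable (fun p : Ω × ℝ≥0 => (Ioc (Φ.a i) (Φ.b i)).indicator (fun _ => Φ.ξ i p.1) p.2) := by
  have h1 : StronglyMeasurable fun p : Ω × ℝ≥0 => Φ.ξ i p.1 :=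
    ((Φ.measurable i).mono ((brownianFiltration hW).le _)).comp_measurable measurable_fst
  exact h1.indicator (measurable_snd measurableSet_Ioc)

theorem memLp_summand (i : Fin Φ.n) :
    MemLp (fun ω => Φ.ξ i ω * (W (min (Φ.b i) T) ω - W (min (Φ.a i) T) ω)) 2 P := by
  obtain ⟨C, hC⟩ := Φ.bounded i
  exact memLp_mul_of_bounded (Φ.aestronglyMeasurable_ξ i) hC (memLp_increment hW _ _)

theorem memLp_integral : MemLp (Φ.integral W T) 2 P :=
  memLp_finsetSum _ fun i _ => Φ.memLp_summand T i

variable [IsProbabilityMeasure P]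

theorem memLp_term (i : Fin Φ.n) :
    MemLp (fun p : Ω × ℝ≥0 => (Ioc (Φ.a i) (Φ.b i)).indicator (fun _ => Φ.ξ i p.1) p.2) 2
      (spaceTime P T) := by
  obtain ⟨C, hC⟩ := Φ.bounded i
  refine MemLp.of_bound (Φ.stronglyMeasurable_term i).aestronglyMeasurable C
    (ae_of_all _ fun p => (norm_indicator_le_norm_self _ _).trans (hC p.1))

theorem memLp_onProd : MemLp (onProd Φ.toFun) 2 (spaceTime P T) :=
  memLp_finsetSum _ fun i _ => Φ.memLp_term T i

/-- The isometry in polarised form, by bilinearity. It gives the norm of a difference without making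
that difference a `SimpleProcess`. -/
theorem integral_mul_integral :
    ∫ ω, Φ.integral W T ω * Ψ.integral W T ω ∂P
      = ∫ p, onProd Φ.toFun p * onProd Ψ.toFun p ∂spaceTime P T := by
  simp only [onProd, toFun, integral, Finset.sum_mul_sum]
  rw [integral_finsetSum, integral_finsetSum]
  · refine Finset.sum_congr rfl fun i _ => ?_
    rw [integral_finsetSum, integral_finsetSum]
    · refine Finset.sum_congr rfl fun j _ => ?_
      obtain ⟨C, hC⟩ := Φ.bounded i
      obtain ⟨C', hC'⟩ := Ψ.bounded j
      exact integral_mul_increments_stopped hW (Φ.le i) (Ψ.le j) (Φ.measurable i) hC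
        (Ψ.measurable j) hC' T
    · exact fun j _ => integrable_fun_mul (Φ.memLp_term T i) (Ψ.memLp_term T j)
    · exact fun j _ => integrable_fun_mul (Φ.memLp_summand T i) (Ψ.memLp_summand T j)
  · exact fun i _ => integrable_finsetSum _ fun j _ =>
      integrable_fun_mul (Φ.memLp_term T i) (Ψ.memLp_term T j)
  · exact fun i _ => integrable_finsetSum _ fun j _ =>
      integrable_fun_mul (Φ.memLp_summand T i) (Ψ.memLp_summand T j)

theorem integral_integral : ∫ ω, Φ.integral W T ω ∂P = 0 := by
  simp only [integral]
  rw [integral_finsetSum _ fun i _ => (Φ.memLp_summand T i).integrable one_le_two]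
  refine Finset.sum_eq_zero fun i _ => ?_
  obtain ⟨C, hC⟩ := Φ.bounded i
  rcases lt_or_ge T (Φ.a i) with h | h
  · simp [min_eq_right h.le, min_eq_right (h.le.trans (Φ.le i))]
  · rw [min_eq_left h]
    exact integral_mul_increment hW (le_min (Φ.le i) h) (Φ.measurable i)
      (MemLp.of_bound (Φ.aestronglyMeasurable_ξ i) C (ae_of_all _ hC))

end SimpleProcess

theorem integral_sub_sq {α : Type*} {mα : MeasurableSpace α} {μ : Measure α} {f g : α → ℝ}
    (hf : MemLp f 2 μ) (hg : MemLp g 2 μ) :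
    ∫ a, (f a - g a) ^ 2 ∂μ
      = ∫ a, f a * f a ∂μ - 2 * ∫ a, f a * g a ∂μ + ∫ a, g a * g a ∂μ := by
  have h1 := integrable_fun_mul hf hf
  have h2 := (integrable_fun_mul hf hg).const_mul 2
  have h3 := integrable_fun_mul hg hg
  rw [← integral_const_mul, ← integral_sub h1 h2, ← integral_add (by exact h1.sub h2) h3]
  congr 1; ext a; ring

theorem SimpleProcess.lintegral_sub_sq [IsProbabilityMeasure P] {hW : IsBrownianReal W P}
    (Φ Ψ : SimpleProcess (brownianFiltration hW)) (T : ℝ≥0) :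
    ∫⁻ ω, ‖Φ.integral W T ω - Ψ.integral W T ω‖ₑ ^ 2 ∂P
      = ∫⁻ p, ‖onProd Φ.toFun p - onProd Ψ.toFun p‖ₑ ^ 2 ∂spaceTime P T := by
  refine (lintegral_enorm_sq_eq_ofReal ((Φ.memLp_integral T).sub (Ψ.memLp_integral T))).trans
    (Eq.trans ?_ (lintegral_enorm_sq_eq_ofReal ((Φ.memLp_onProd T).sub (Ψ.memLp_onProd T))).symm)
  simp only [Pi.sub_apply]
  rw [integral_sub_sq (Φ.memLp_integral T) (Ψ.memLp_integral T),
    integral_sub_sq (Φ.memLp_onProd T) (Ψ.memLp_onProd T), integral_mul_integral,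
    integral_mul_integral, integral_mul_integral]

end SimpleIntegral

/-! ### Density of simple processes in the progressive `L²` processes. -/

section Density

variable {Ω : Type*} {mΩ : MeasurableSpace Ω} {P : Measure Ω} {ℱ : Filtration ℝ≥0 mΩ}
  {φ : ℝ≥0 → Ω → ℝ}

theorem stronglyMeasurable_setIntegral {m : MeasurableSpace Ω} {T : ℝ≥0}
    (hφ : StronglyMeasurable fun p : Iic T × Ω => φ p.1 p.2) (a : ℝ≥0) :
    StronglyMeasurable fun ω => ∫ s in Icc a T, φ s ω ∂lebesgue := by
  have h := (stronglyMeasurable_stopped hφ).integral_prod_right' (ν := lebesgue.restrict (Icc a T))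
  convert h using 1
  ext ω
  refine setIntegral_congr_fun measurableSet_Icc fun s hs => ?_
  simp [hs.2]

/-- The average of `φ` over `[(j - 1) / n, j / n]`. -/
noncomputable def gridAverage (φ : ℝ≥0 → Ω → ℝ) (n j : ℕ) (ω : Ω) : ℝ :=
  n * ∫ s in Icc (((j - 1 : ℕ) : ℝ≥0) / n) ((j : ℝ≥0) / n), φ s ω ∂lebesgue

/-- The interval has length at most `1 / n`; for `j = 0` truncated subtraction collapses it to a
point. -/
theorem abs_gridAverage_le {C : ℝ} (hC0 : 0 ≤ C) (hC : ∀ t ω, |φ t ω| ≤ C) (n j : ℕ) (ω : Ω) :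
    |gridAverage φ n j ω| ≤ C := by
  rcases Nat.eq_zero_or_pos n with rfl | hn
  · simpa [gridAverage] using hC0
  have hn' : (0 : ℝ) < n := Nat.cast_pos.2 hn
  have h1 : ‖∫ s in Icc (((j - 1 : ℕ) : ℝ≥0) / n) ((j : ℝ≥0) / n), φ s ω ∂lebesgue‖
      ≤ C * lebesgue.real (Icc (((j - 1 : ℕ) : ℝ≥0) / n) ((j : ℝ≥0) / n)) :=
    norm_setIntegral_le_of_norm_le_const
      (by rw [lebesgue_Icc]; exact ENNReal.ofReal_lt_top) fun s _ => hC s ω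
  have h2 : lebesgue.real (Icc (((j - 1 : ℕ) : ℝ≥0) / n) ((j : ℝ≥0) / n)) ≤ 1 / n := by
    rw [measureReal_def, lebesgue_Icc, ENNReal.toReal_ofReal', max_le_iff]
    refine ⟨?_, by positivity⟩
    simp only [NNReal.coe_div, NNReal.coe_natCast]
    rw [← sub_div]
    gcongr
    have : (j : ℝ) ≤ ((j - 1 : ℕ) : ℝ) + 1 := by
      exact_mod_cast (by omega : j ≤ (j - 1) + 1)
    linarith
  rw [gridAverage, abs_mul, Nat.abs_cast]
  calc (n : ℝ) * |∫ s in Icc (((j - 1 : ℕ) : ℝ≥0) / n) ((j : ℝ≥0) / n), φ s ω ∂lebesgue|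
      ≤ n * (C * (1 / n)) := by
        gcongr
        exact h1.trans (by gcongr)
    _ = C := by field_simp

/-- The simple process equal to the average of `φ` over `[(i - 1) / n, i / n]` on
`(i / n, (i + 1) / n]`, for `i < n`. -/
noncomputable def stepProcess (hφ : IsStronglyProgressive ℱ φ) {C : ℝ} (hC0 : 0 ≤ C)
    (hC : ∀ t ω, |φ t ω| ≤ C) (n : ℕ) : SimpleProcess ℱ where
  n := n
  a i := (i : ℕ) / n
  b i := ((i : ℕ) + 1) / n
  ξ i := gridAverage φ n i
  le i := by gcongr; exact le_self_add
  -- The averaging interval ends at `i / n`, where the coefficient starts to act; looking backward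
  -- keeps it adapted.
  measurable i := (stronglyMeasurable_setIntegral (hφ _) _).const_mul _
  bounded i := ⟨C, fun ω => abs_gridAverage_le hC0 hC n i ω⟩

theorem stepProcess_toFun (hφ : IsStronglyProgressive ℱ φ) {C : ℝ} (hC0 : 0 ≤ C)
    (hC : ∀ t ω, |φ t ω| ≤ C) {n : ℕ} (hn : 0 < n) {t : ℝ≥0} (ht0 : 0 < t) (ht1 : t ≤ 1) (ω : Ω) :
    (stepProcess hφ hC0 hC n).toFun t ω = gridAverage φ n (⌈(n : ℝ≥0) * t⌉₊ - 1) ω := by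
  have hn' : (0 : ℝ≥0) < n := Nat.cast_pos.2 hn
  have hc0 : 0 < ⌈(n : ℝ≥0) * t⌉₊ := Nat.ceil_pos.2 (mul_pos hn' ht0)
  have hcn : ⌈(n : ℝ≥0) * t⌉₊ ≤ n := Nat.ceil_le.2 (mul_le_of_le_one_right hn'.le ht1)
  have hmem : ∀ i : ℕ, t ∈ Ioc ((i : ℝ≥0) / n) (((i : ℝ≥0) + 1) / n) ↔
      ⌈(n : ℝ≥0) * t⌉₊ = i + 1 := fun i => by
    rw [Nat.ceil_eq_iff (Nat.succ_ne_zero i), mem_Ioc, div_lt_iff₀ hn', le_div_iff₀ hn',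
      mul_comm t, Nat.succ_sub_one, Nat.cast_succ]
  unfold SimpleProcess.toFun
  have hlt : ⌈(n : ℝ≥0) * t⌉₊ - 1 < n := by omega
  refine (Finset.sum_eq_single (⟨⌈(n : ℝ≥0) * t⌉₊ - 1, hlt⟩ : Fin n) ?_ ?_).trans ?_
  rotate_left 2
  · refine indicator_of_mem ?_ _
    exact (hmem (⌈(n : ℝ≥0) * t⌉₊ - 1)).2 (by omega)
  · intro i _ hi
    refine indicator_of_notMem (fun h => hi ?_) _
    have := (hmem i).1 h
    exact Fin.ext (by simp; omega)
  · exact fun h => absurd (Finset.mem_univ _) h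

/-- Puts the average in the ball form required by the Lebesgue differentiation theorem. -/
theorem gridAverage_eq_average {n j : ℕ} (hn : 0 < n) (hj : 1 ≤ j) (ω : Ω) :
    gridAverage φ n j ω = ⨍ y in Metric.closedBall (((j : ℝ) - 1 / 2) / n) (1 / (2 * n)),
      φ y.toNNReal ω := by
  have hn' : (0 : ℝ) < n := Nat.cast_pos.2 hn
  have h := setIntegral_lebesgue_Icc (fun y => φ y.toNNReal ω) (((j - 1 : ℕ) : ℝ≥0) / n)
    ((j : ℝ≥0) / n)
  simp only [Real.toNNReal_coe] at h
  rw [gridAverage, h, setAverage_eq, Real.closedBall_eq_Icc, measureReal_def, Real.volume_Icc,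
    smul_eq_mul]
  simp only [NNReal.coe_div, NNReal.coe_natCast, Nat.cast_sub hj, Nat.cast_one]
  have e1 : ((j : ℝ) - 1 / 2) / n - 1 / (2 * n) = (j - 1) / n := by field_simp; ring
  have e2 : ((j : ℝ) - 1 / 2) / n + 1 / (2 * n) = j / n := by field_simp; ring
  have e3 : (j : ℝ) / n - (j - 1) / n = 1 / n := by field_simp; ring
  rw [e1, e2, e3, ENNReal.toReal_ofReal (by positivity)]
  simp

theorem ae_tendsto_stepProcess (hφ : IsStronglyProgressive ℱ φ) {C : ℝ} (hC0 : 0 ≤ C)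
    (hC : ∀ t ω, |φ t ω| ≤ C) (ω : Ω) (hm : Measurable fun t => φ t ω) :
    ∀ᵐ t ∂timeMeasure 1,
      Tendsto (fun n => (stepProcess hφ hC0 hC n).toFun t ω) atTop (𝓝 (φ t ω)) := by
  have hli : LocallyIntegrable (fun y : ℝ => φ y.toNNReal ω) :=
    (locallyIntegrable_const C).mono (hm.comp measurable_real_toNNReal).aestronglyMeasurable
      (ae_of_all _ fun y => by
        rw [Real.norm_of_nonneg hC0]; exact hC _ ω)
  have h0 : ∀ᵐ t ∂lebesgue, t ≠ 0 := by
    have : ∀ᵐ y : ℝ, y ≠ 0 := Measure.ae_ne volume 0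
    filter_upwards [ae_lebesgue_of_ae_volume this] with t ht
    exact fun h => ht (by simp [h])
  have hae := ae_lebesgue_of_ae_volume
    (IsUnifLocDoublingMeasure.ae_tendsto_average volume hli 3)
  filter_upwards [ae_restrict_of_ae hae, ae_restrict_of_ae h0, ae_timeMeasure_le 1]
    with t ht ht0 ht1
  have ht0' : 0 < t := pos_of_ne_zero ht0
  have hlim : Tendsto (fun n : ℕ => (1 : ℝ) / (2 * n)) atTop (𝓝[>] 0) := by
    refine tendsto_nhdsWithin_iff.2 ⟨?_, ?_⟩
    · have := (tendsto_const_div_atTop_nhds_zero_nat (1 / 2 : ℝ))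
      refine this.congr fun n => ?_
      rw [div_div]
    · filter_upwards [eventually_gt_atTop 0] with n hn
      have : (0 : ℝ) < n := Nat.cast_pos.2 hn
      exact mem_Ioi.2 (by positivity)
  -- The averaging interval precedes the grid cell of `t`, so `t` lies only in its threefold dilate;
  -- hence the dilation constant `3` in `hae`.
  have hmem : ∀ᶠ n : ℕ in atTop, (t : ℝ) ∈ Metric.closedBall
      ((((⌈(n : ℝ≥0) * t⌉₊ - 1 : ℕ) : ℝ) - 1 / 2) / n) (3 * (1 / (2 * n))) := by
    filter_upwards [eventually_gt_atTop 0] with n hn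
    have hn' : (0 : ℝ) < n := Nat.cast_pos.2 hn
    have hc : 0 < ⌈(n : ℝ≥0) * t⌉₊ := Nat.ceil_pos.2 (mul_pos (Nat.cast_pos.2 hn) ht0')
    have h1 : (n : ℝ) * t ≤ ⌈(n : ℝ≥0) * t⌉₊ := by
      exact_mod_cast Nat.le_ceil ((n : ℝ≥0) * t)
    have h2 : (⌈(n : ℝ≥0) * t⌉₊ : ℝ) < n * t + 1 := by
      exact_mod_cast Nat.ceil_lt_add_one (zero_le (a := (n : ℝ≥0) * t))
    rw [Nat.cast_sub hc, Metric.mem_closedBall, Real.dist_eq, abs_le]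
    have e : (t : ℝ) - ((⌈(n : ℝ≥0) * t⌉₊ : ℝ) - (1 : ℕ) - 1 / 2) / n
        = (n * t - ⌈(n : ℝ≥0) * t⌉₊ + 3 / 2) / n := by field_simp; push_cast; ring
    have e' : 3 * (1 / (2 * (n : ℝ))) = (3 / 2) / n := by field_simp
    rw [e, e', ← neg_div]
    constructor
    · gcongr; linarith
    · gcongr; linarith
  have hconv := ht _ _ hlim hmem
  simp only [Real.toNNReal_coe] at hconv
  refine hconv.congr' ?_
  -- Past this point the grid index is at least `1`, so the averaging interval is not degenerate.
  have hbig : ∀ᶠ n : ℕ in atTop, 1 < (n : ℝ≥0) * t := by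
    have : Tendsto (fun n : ℕ => (n : ℝ≥0) * t) atTop atTop :=
      tendsto_natCast_atTop_atTop.atTop_mul_const ht0'
    exact this.eventually_gt_atTop 1
  filter_upwards [eventually_gt_atTop 0, hbig] with n hn hb
  have hc : 1 < ⌈(n : ℝ≥0) * t⌉₊ := Nat.lt_ceil.2 (by exact_mod_cast hb)
  rw [stepProcess_toFun hφ hC0 hC hn ht0' ht1, gridAverage_eq_average hn (by omega)]

theorem abs_stepProcess_le (hφ : IsStronglyProgressive ℱ φ) {C : ℝ} (hC0 : 0 ≤ C)
    (hC : ∀ t ω, |φ t ω| ≤ C) {n : ℕ} {t : ℝ≥0} (ht1 : t ≤ 1) (ω : Ω) :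
    |(stepProcess hφ hC0 hC n).toFun t ω| ≤ C := by
  rcases Nat.eq_zero_or_pos n with rfl | hn
  · have : (stepProcess hφ hC0 hC 0).toFun t ω = 0 := Finset.sum_eq_zero fun i _ => Fin.elim0 i
    simpa [this] using hC0
  rcases eq_zero_or_pos t with rfl | ht0
  · have : (stepProcess hφ hC0 hC n).toFun 0 ω = 0 :=
      Finset.sum_eq_zero fun i _ => indicator_of_notMem (fun h => not_lt_zero h.1) _
    simpa [this] using hC0
  rw [stepProcess_toFun hφ hC0 hC hn ht0 ht1]
  exact abs_gridAverage_le hC0 hC n _ ω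

/-- The process `φ` clamped to `[-C, C]` and set to zero after time `1`. -/
noncomputable def clampStop (C : ℝ) (φ : ℝ≥0 → Ω → ℝ) (t : ℝ≥0) (ω : Ω) : ℝ :=
  if t ≤ 1 then max (-C) (min C (φ t ω)) else 0

theorem abs_clamp_le {C : ℝ} (hC0 : 0 ≤ C) (x : ℝ) : |max (-C) (min C x)| ≤ C :=
  abs_le.2 ⟨le_max_left _ _, max_le (by linarith) (min_le_left _ _)⟩

theorem abs_clamp_sub_le {C : ℝ} (hC0 : 0 ≤ C) (x : ℝ) : |max (-C) (min C x) - x| ≤ |x| := by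
  rcases le_total 0 x with h | h
  · have h1 : 0 ≤ min C x := le_min hC0 h
    rw [max_eq_right (by linarith), abs_of_nonneg h, abs_le]
    exact ⟨by linarith, by linarith [min_le_right C x]⟩
  · rw [min_eq_right (h.trans hC0), abs_of_nonpos h, abs_le]
    exact ⟨by linarith [le_max_right (-C) x], by linarith [max_le (by linarith : -C ≤ 0) h]⟩

theorem clamp_eq_self {C x : ℝ} (h : |x| ≤ C) : max (-C) (min C x) = x := by
  rw [abs_le] at h
  rw [min_eq_right h.2, max_eq_right h.1]

theorem abs_clampStop_le {C : ℝ} (hC0 : 0 ≤ C) (t : ℝ≥0) (ω : Ω) : |clampStop C φ t ω| ≤ C := by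
  unfold clampStop
  split_ifs
  · exact abs_clamp_le hC0 _
  · simpa using hC0

theorem isStronglyProgressive_clampStop (hφ : IsStronglyProgressive ℱ φ) (C : ℝ) :
    IsStronglyProgressive ℱ (clampStop C φ) := fun T => by
  let _ : MeasurableSpace Ω := ℱ T
  have h1 : StronglyMeasurable fun p : Iic T × Ω => max (-C) (min C (φ p.1 p.2)) :=
    (continuous_const.max (continuous_const.min continuous_id)).comp_stronglyMeasurable (hφ T)
  have hs : MeasurableSet {p : Iic T × Ω | (p.1 : ℝ≥0) ≤ 1} :=
    measurableSet_le (measurable_subtype_coe.comp measurable_fst) measurable_const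
  exact StronglyMeasurable.ite hs h1 stronglyMeasurable_const

theorem stronglyMeasurable_clampStop (hφ : IsStronglyProgressive ℱ φ) (C : ℝ) :
    StronglyMeasurable (onProd (clampStop C φ)) := by
  have h := (stronglyMeasurable_stopped (isStronglyProgressive_clampStop hφ C 1)).mono
    (sup_le_sup (MeasurableSpace.comap_mono (ℱ.le 1)) le_rfl)
  have e : onProd (clampStop C φ)
      = fun p : Ω × ℝ≥0 => if p.2 ≤ 1 then clampStop C φ p.2 p.1 else 0 := by
    ext p
    by_cases hp : p.2 ≤ 1 <;> simp [clampStop, hp]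
  rw [e]
  exact h

theorem tendsto_clampStop [IsProbabilityMeasure P]
    (hφ : MemLp (onProd φ) 2 (spaceTime P 1)) (hp : IsStronglyProgressive ℱ φ) :
    Tendsto (fun n : ℕ => eLpNorm (onProd (clampStop n φ) - onProd φ) 2 (spaceTime P 1))
      atTop (𝓝 0) := by
  refine tendsto_eLpNorm_of_tendsto_lintegral ?_
  have h := tendsto_lintegral_of_dominated_convergence' (μ := spaceTime P 1)
    (F := fun (n : ℕ) p => ‖(onProd (clampStop n φ) - onProd φ) p‖ₑ ^ 2) (f := fun _ => 0)
    (fun p => ‖onProd φ p‖ₑ ^ 2) (fun n => ?_) (fun n => ?_) ?_ ?_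
  · simpa using h
  · exact ((((stronglyMeasurable_clampStop hp n).aestronglyMeasurable).sub hφ.1).enorm.pow_const 2)
  · filter_upwards [ae_spaceTime_le 1] with p hp1
    gcongr
    rw [enorm_le_iff_norm_le]
    simpa [clampStop, hp1] using abs_clamp_sub_le (Nat.cast_nonneg n) (φ p.2 p.1)
  · rw [lintegral_enorm_sq_eq_eLpNorm_sq]
    exact (ENNReal.pow_lt_top hφ.2).ne
  · filter_upwards [ae_spaceTime_le 1] with p hp1
    refine tendsto_const_nhds.congr' ?_
    filter_upwards [eventually_ge_atTop ⌈|φ p.2 p.1|⌉₊] with n hn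
    have : |φ p.2 p.1| ≤ n := (Nat.le_ceil _).trans (Nat.cast_le.2 hn)
    simp [clampStop, hp1, clamp_eq_self this]

theorem SimpleProcess.stronglyMeasurable_onProd (Φ : SimpleProcess ℱ) :
    StronglyMeasurable (onProd Φ.toFun) := by
  refine Finset.stronglyMeasurable_fun_sum _ fun i _ => ?_
  have h1 : StronglyMeasurable fun p : Ω × ℝ≥0 => Φ.ξ i p.1 :=
    ((Φ.measurable i).mono (ℱ.le _)).comp_measurable measurable_fst
  exact h1.indicator (measurable_snd measurableSet_Ioc)

/-- Dominated convergence twice, in `t` for each fixed `ω` and then in `ω`, with the constant bound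
`(2 C)²`. -/
theorem tendsto_stepProcess [IsProbabilityMeasure P] (hφ : IsStronglyProgressive ℱ φ) {C : ℝ}
    (hC0 : 0 ≤ C) (hC : ∀ t ω, |φ t ω| ≤ C) (hm : StronglyMeasurable (onProd φ)) :
    Tendsto (fun n => eLpNorm (onProd (stepProcess hφ hC0 hC n).toFun - onProd φ) 2
      (spaceTime P 1)) atTop (𝓝 0) := by
  refine tendsto_eLpNorm_of_tendsto_lintegral ?_
  have hmeas : ∀ n, Measurable fun p =>
      ‖(onProd (stepProcess hφ hC0 hC n).toFun - onProd φ) p‖ₑ ^ 2 := fun n =>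
    (((SimpleProcess.stronglyMeasurable_onProd _).sub hm).enorm.pow_const 2)
  simp_rw [fun n => lintegral_prod (μ := P) (ν := timeMeasure 1) _ (hmeas n).aemeasurable]
  have hbound : ∀ n ω, ∀ᵐ t ∂timeMeasure 1,
      ‖(onProd (stepProcess hφ hC0 hC n).toFun - onProd φ) (ω, t)‖ₑ ^ 2
        ≤ ENNReal.ofReal (2 * C) ^ 2 := fun n ω => by
    filter_upwards [ae_timeMeasure_le 1] with t ht
    gcongr
    rw [← ofReal_norm]
    refine ENNReal.ofReal_le_ofReal ?_
    refine (norm_sub_le _ _).trans ?_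
    have h1 := abs_stepProcess_le hφ hC0 hC (n := n) ht ω
    have h2 := hC t ω
    simp only [Real.norm_eq_abs, onProd]
    linarith
  have hfin : ∫⁻ _, ENNReal.ofReal (2 * C) ^ 2 ∂timeMeasure 1 ≠ ∞ := by
    rw [lintegral_const]
    exact ENNReal.mul_ne_top (by finiteness) (measure_ne_top _ _)
  have hinner : ∀ ω, Tendsto (fun n => ∫⁻ t, ‖(onProd (stepProcess hφ hC0 hC n).toFun
      - onProd φ) (ω, t)‖ₑ ^ 2 ∂timeMeasure 1) atTop (𝓝 0) := fun ω => by
    have h := tendsto_lintegral_of_dominated_convergence' (μ := timeMeasure 1)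
      (F := fun n t => ‖(onProd (stepProcess hφ hC0 hC n).toFun - onProd φ) (ω, t)‖ₑ ^ 2)
      (f := fun _ => 0) (fun _ => ENNReal.ofReal (2 * C) ^ 2)
      (fun n => ((hmeas n).comp measurable_prodMk_left).aemeasurable) (fun n => hbound n ω) hfin ?_
    · simpa using h
    · filter_upwards [ae_tendsto_stepProcess hφ hC0 hC ω
        (hm.measurable.comp measurable_prodMk_left)] with t ht
      have h1 := ((ht.sub_const (φ t ω)).enorm).ennrpow_const 2
      simpa using h1
  have h := tendsto_lintegral_of_dominated_convergence' (μ := P)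
    (F := fun n ω => ∫⁻ t, ‖(onProd (stepProcess hφ hC0 hC n).toFun
      - onProd φ) (ω, t)‖ₑ ^ 2 ∂timeMeasure 1)
    (f := fun _ => 0) (fun _ => ∫⁻ _, ENNReal.ofReal (2 * C) ^ 2 ∂timeMeasure 1)
    (fun n => (hmeas n).lintegral_prod_right'.aemeasurable)
    (fun n => ae_of_all _ fun ω => lintegral_mono_ae (hbound n ω))
    (by rw [lintegral_const]; exact ENNReal.mul_ne_top hfin (measure_ne_top _ _))
    (ae_of_all _ hinner)
  simpa using h

theorem exists_simpleProcess_eLpNorm_le [IsProbabilityMeasure P] (hp : IsStronglyProgressive ℱ φ)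
    (hφ : MemLp (onProd φ) 2 (spaceTime P 1)) {ε : ℝ≥0∞} (hε : 0 < ε) :
    ∃ Ψ : SimpleProcess ℱ, eLpNorm (onProd Ψ.toFun - onProd φ) 2 (spaceTime P 1) ≤ ε := by
  have hε2 : 0 < ε / 2 := ENNReal.half_pos hε.ne'
  obtain ⟨n, hn⟩ := ((tendsto_clampStop hφ hp).eventually_lt_const hε2).exists
  obtain ⟨k, hk⟩ := ((tendsto_stepProcess (P := P) (isStronglyProgressive_clampStop hp n)
    (Nat.cast_nonneg n) (abs_clampStop_le (Nat.cast_nonneg n))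
    (stronglyMeasurable_clampStop hp n)).eventually_lt_const hε2).exists
  refine ⟨stepProcess (isStronglyProgressive_clampStop hp n) (Nat.cast_nonneg n)
    (abs_clampStop_le (Nat.cast_nonneg n)) k, ?_⟩
  rw [← sub_add_sub_cancel _ (onProd (clampStop n φ)) (onProd φ), ← ENNReal.add_halves ε]
  exact (eLpNorm_add_le ((SimpleProcess.stronglyMeasurable_onProd _).sub
    (stronglyMeasurable_clampStop hp n)).aestronglyMeasurable
    ((stronglyMeasurable_clampStop hp n).aestronglyMeasurable.sub hφ.1) one_le_two).trans
    (add_le_add hk.le hn.le)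

end Density

/-- Continuity of the `L²` inner product; it carries the mean and the isometry from simple processes
to the limit. -/
theorem tendsto_integral_mul {α : Type*} {mα : MeasurableSpace α} {μ : Measure α}
    {f g : ℕ → α → ℝ} {f' g' : α → ℝ} (hf : ∀ n, MemLp (f n) 2 μ) (hf' : MemLp f' 2 μ)
    (hg : ∀ n, MemLp (g n) 2 μ) (hg' : MemLp g' 2 μ)
    (hft : Tendsto (fun n => eLpNorm (f n - f') 2 μ) atTop (𝓝 0))
    (hgt : Tendsto (fun n => eLpNorm (g n - g') 2 μ) atTop (𝓝 0)) :
    Tendsto (fun n => ∫ a, f n a * g n a ∂μ) atTop (𝓝 (∫ a, f' a * g' a ∂μ)) := by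
  have key : ∀ {u v : α → ℝ} (hu : MemLp u 2 μ) (hv : MemLp v 2 μ),
      inner ℝ (hu.toLp u) (hv.toLp v) = ∫ a, u a * v a ∂μ := fun {u v} hu hv => by
    rw [L2.inner_def]
    refine integral_congr_ae ?_
    filter_upwards [hu.coeFn_toLp, hv.coeFn_toLp] with a h1 h2
    rw [h1, h2, real_inner_eq_re_inner, RCLike.inner_apply]
    simp [mul_comm]
  have h1 := (Lp.tendsto_Lp_iff_tendsto_eLpNorm'' f hf f' hf').2 hft
  have h2 := (Lp.tendsto_Lp_iff_tendsto_eLpNorm'' g hg g' hg').2 hgt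
  have h3 := h1.inner (𝕜 := ℝ) h2
  simpa only [key] using h3

/-! ### Existence, mean and isometry of the Itô integral. -/

section Ito

variable {Ω : Type*} {mΩ : MeasurableSpace Ω} {P : Measure Ω} {W : ℝ≥0 → Ω → ℝ}
  [IsProbabilityMeasure P] [P.IsComplete] {hW : IsBrownianReal W P} {φ : ℝ≥0 → Ω → ℝ} {T : ℝ≥0}

theorem SimpleProcess.eLpNorm_sub (Φ Ψ : SimpleProcess (brownianFiltration hW)) (T : ℝ≥0) :
    eLpNorm (Φ.integral W T - Ψ.integral W T) 2 P
      = eLpNorm (onProd Φ.toFun - onProd Ψ.toFun) 2 (spaceTime P T) := by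
  have h := Φ.lintegral_sub_sq Ψ T
  have h1 := lintegral_enorm_sq_eq_eLpNorm_sq (μ := P) (Φ.integral W T - Ψ.integral W T)
  have h2 := lintegral_enorm_sq_eq_eLpNorm_sq (μ := spaceTime P T)
    (onProd Φ.toFun - onProd Ψ.toFun)
  simp only [Pi.sub_apply] at h1 h2
  rw [h1, h2] at h
  exact (ENNReal.pow_right_strictMono two_ne_zero).injective h

/-- Simple processes within `2⁻ᵏ` of `φ` have Cauchy integrals by the isometry, and `L²` is
complete. -/
theorem exists_isItoIntegral (hT : T ≤ 1)
    (hp : IsStronglyProgressive (brownianFiltration hW) φ)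
    (hφ : MemLp (onProd φ) 2 (spaceTime P 1)) : ∃ I, IsItoIntegral hW φ T I := by
  have hpos : ∀ k : ℕ, (0 : ℝ≥0∞) < (1 / 2) ^ k := fun k =>
    ENNReal.pow_pos (by simp) k
  choose Φ hΦ1 using fun k : ℕ => exists_simpleProcess_eLpNorm_le hp hφ (hpos k)
  have hφT : MemLp (onProd φ) 2 (spaceTime P T) := hφ.mono_measure (spaceTime_mono hT)
  have hΦ : ∀ k, eLpNorm (onProd (Φ k).toFun - onProd φ) 2 (spaceTime P T) ≤ (1 / 2) ^ k :=
    fun k => (eLpNorm_mono_measure _ (spaceTime_mono hT)).trans (hΦ1 k)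
  -- The triangle inequality gives the factor `2`; the factor `3` makes the bound strict, as the
  -- completeness lemma demands.
  have hcau : ∀ N n m : ℕ, N ≤ n → N ≤ m →
      eLpNorm ((Φ n).integral W T - (Φ m).integral W T) 2 P < 3 * (1 / 2) ^ N := by
    intro N n m hn hm
    have hmono : ∀ k, N ≤ k → ((1 : ℝ≥0∞) / 2) ^ k ≤ (1 / 2) ^ N := fun k hk =>
      pow_le_pow_right_of_le_one' (by simp) hk
    rw [SimpleProcess.eLpNorm_sub, ← sub_sub_sub_cancel_right _ _ (onProd φ)]
    refine ((eLpNorm_sub_le (((Φ n).memLp_onProd T).sub hφT).1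
      (((Φ m).memLp_onProd T).sub hφT).1 one_le_two).trans
      (add_le_add ((hΦ n).trans (hmono n hn)) ((hΦ m).trans (hmono m hm)))).trans_lt ?_
    rw [← two_mul]
    refine ENNReal.mul_lt_mul_left (hpos N).ne' ?_ (by norm_num)
    exact (ENNReal.pow_lt_top (by simp)).ne
  have hsum : ∑' N : ℕ, (3 : ℝ≥0∞) * (1 / 2) ^ N ≠ ∞ := by
    rw [ENNReal.tsum_mul_left, ENNReal.tsum_geometric]
    refine ENNReal.mul_ne_top (by simp) ?_
    simp
  obtain ⟨I, hI, hlim⟩ := Lp.cauchy_complete_eLpNorm one_le_two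
    (fun k => (Φ k).memLp_integral T) hsum hcau
  refine ⟨I, hI, Φ, ?_, tendsto_lintegral_of_tendsto_eLpNorm hlim⟩
  have hE : ∀ k, energy P T (fun t ω => (Φ k).toFun t ω - φ t ω)
      = ∫⁻ p, ‖(onProd (Φ k).toFun - onProd φ) p‖ₑ ^ 2 ∂spaceTime P T := fun k =>
    energy_eq (((Φ k).memLp_onProd T).sub hφT).1
  simp_rw [hE]
  refine tendsto_lintegral_of_tendsto_eLpNorm ?_
  exact tendsto_of_tendsto_of_tendsto_of_le_of_le tendsto_const_nhds
    (ENNReal.tendsto_pow_atTop_nhds_zero_of_lt_one (by simp)) (fun _ => zero_le) hΦ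

theorem isItoIntegral_itoIntegral (hT : T ≤ 1)
    (hp : IsStronglyProgressive (brownianFiltration hW) φ)
    (hφ : MemLp (onProd φ) 2 (spaceTime P 1)) : IsItoIntegral hW φ T (itoIntegral hW φ T) := by
  have h := exists_isItoIntegral hT hp hφ
  rw [itoIntegral, dif_pos h]
  exact h.choose_spec

namespace IsItoIntegral

variable {I : Ω → ℝ}

theorem integral_eq_zero (h : IsItoIntegral hW φ T I) : ∫ ω, I ω ∂P = 0 := by
  obtain ⟨hI, Φ, -, hlim⟩ := h
  have h1 := tendsto_integral_mul (fun k => (Φ k).memLp_integral T) hI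
    (fun _ => memLp_const (1 : ℝ)) (memLp_const (1 : ℝ))
    (tendsto_eLpNorm_of_tendsto_lintegral hlim) (by simp)
  simp only [mul_one, SimpleProcess.integral_integral] at h1
  exact tendsto_nhds_unique h1 tendsto_const_nhds

theorem integral_sq (h : IsItoIntegral hW φ T I) (hφ : MemLp (onProd φ) 2 (spaceTime P T)) :
    ∫ ω, I ω ^ 2 ∂P = ∫ p, onProd φ p ^ 2 ∂spaceTime P T := by
  obtain ⟨hI, Φ, hΦ, hlim⟩ := h
  have hlim' := tendsto_eLpNorm_of_tendsto_lintegral hlim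
  have hE : ∀ k, energy P T (fun t ω => (Φ k).toFun t ω - φ t ω)
      = ∫⁻ p, ‖(onProd (Φ k).toFun - onProd φ) p‖ₑ ^ 2 ∂spaceTime P T := fun k =>
    energy_eq (((Φ k).memLp_onProd T).sub hφ).1
  simp_rw [hE] at hΦ
  have hΦ' := tendsto_eLpNorm_of_tendsto_lintegral hΦ
  have h1 := tendsto_integral_mul (fun k => (Φ k).memLp_integral T) hI
    (fun k => (Φ k).memLp_integral T) hI hlim' hlim'
  have h2 := tendsto_integral_mul (fun k => (Φ k).memLp_onProd T) hφ
    (fun k => (Φ k).memLp_onProd T) hφ hΦ' hΦ'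
  simp only [SimpleProcess.integral_mul_integral] at h1
  simpa only [sq] using tendsto_nhds_unique h1 h2

end IsItoIntegral

end Ito

/-! ### Drift, noise and the reduced form of the payoff. -/

section Payoff

variable {Ω : Type*} {mΩ : MeasurableSpace Ω} {P : Measure Ω} {W : ℝ≥0 → Ω → ℝ}

theorem isStronglyProgressive_deterministic (ℱ : Filtration ℝ≥0 mΩ) {g : ℝ≥0 → ℝ}
    (hg : Measurable g) : IsStronglyProgressive ℱ (fun t (_ : Ω) => g t) := fun T => by
  let _ : MeasurableSpace Ω := ℱ T
  exact (hg.comp (measurable_subtype_coe.comp measurable_fst)).stronglyMeasurable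

theorem memLp_weight {g : ℝ≥0 → ℝ} (hg : Measurable g) {C : ℝ} (hC : ∀ t ≤ 1, |g t| ≤ C)
    {f : Ω × ℝ≥0 → ℝ} (hf : MemLp f 2 (spaceTime P 1)) :
    MemLp (fun p => g p.2 * f p) 2 (spaceTime P 1) := by
  refine MemLp.of_le_mul (c := C) hf
    ((hg.comp measurable_snd).aestronglyMeasurable.mul hf.1) ?_
  filter_upwards [ae_spaceTime_le 1] with p hp
  rw [norm_mul]
  exact mul_le_mul_of_nonneg_right (hC _ hp) (norm_nonneg _)

theorem abs_coe_le_one (t : ℝ≥0) (ht : t ≤ 1) : |(t : ℝ)| ≤ 1 := by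
  rw [abs_of_nonneg t.coe_nonneg]
  exact_mod_cast ht

theorem abs_sqrt_coe_le_one (t : ℝ≥0) (ht : t ≤ 1) : |√(t : ℝ)| ≤ 1 := by
  rw [abs_of_nonneg (Real.sqrt_nonneg _), Real.sqrt_le_one]
  exact_mod_cast ht

theorem integral_sqrt_sq : ∫ t : ℝ≥0, √(t : ℝ) ^ 2 ∂timeMeasure 1 = 1 / 2 := by
  simp_rw [fun t : ℝ≥0 => Real.sq_sqrt t.coe_nonneg]
  rw [integral_timeMeasure (fun t => t), integral_id]
  norm_num

/-- The drift `∫₀¹ √s u(s) ds`. -/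
noncomputable def drift (u : ℝ≥0 → Ω → ℝ) (ω : Ω) : ℝ :=
  ∫ s in Icc 0 1, √(s : ℝ) * u s ω ∂lebesgue

variable {u : ℝ≥0 → Ω → ℝ}

theorem aestronglyMeasurable_drift (hu : MemLp (onProd u) 2 (spaceTime P 1)) :
    AEStronglyMeasurable (drift u) P :=
  (memLp_weight (g := fun t => √(t : ℝ)) (by fun_prop) abs_sqrt_coe_le_one hu).1.integral_prod_right'

/-- The diffusion coefficient `t u(t)`. -/
def diffusion (u : ℝ≥0 → Ω → ℝ) (t : ℝ≥0) (ω : Ω) : ℝ := t * u t ω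

theorem Control.memLp [P.IsComplete] {hW : IsBrownianReal W P} (u : Control hW 1) :
    MemLp (onProd u.1) 2 (spaceTime P 1) :=
  memLp_onProd (aestronglyMeasurable_onProd u.2.1 1) u.2.2

theorem Control.memLp_diffusion [P.IsComplete] {hW : IsBrownianReal W P} (u : Control hW 1) :
    MemLp (onProd (diffusion u.1)) 2 (spaceTime P 1) :=
  memLp_weight (g := fun t => (t : ℝ)) (by fun_prop) abs_coe_le_one u.memLp

/-- The noise term `∫₀¹ s u(s) dW(s)`. -/
noncomputable def noise [P.IsComplete] {hW : IsBrownianReal W P} (u : Control hW 1) : Ω → ℝ :=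
  itoIntegral hW (diffusion u.1) 1

theorem integrable_cross [P.IsComplete] {hW : IsBrownianReal W P} (u₁ u₂ : Control hW 1) :
    Integrable (fun p => onProd u₁.1 p * onProd (diffusion u₂.1) p) (spaceTime P 1) :=
  integrable_fun_mul u₁.memLp u₂.memLp_diffusion

theorem integrable_running [P.IsComplete] {hW : IsBrownianReal W P} (u₁ u₂ : Control hW 1) :
    Integrable (fun p => 2 * (onProd u₁.1 p * onProd (diffusion u₂.1) p)
      - onProd (diffusion u₂.1) p ^ 2) (spaceTime P 1) :=
  ((integrable_cross u₁ u₂).const_mul 2).sub u₂.memLp_diffusion.integrable_sq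

theorem payoff_eq [P.IsComplete] {hW : IsBrownianReal W P} (x : ℝ) (u₁ u₂ : Control hW 1) (ω : Ω) :
    payoff hW x u₁ u₂ ω = ((x + drift u₁.1 ω) + noise u₂ ω) ^ 2 +
    ∫ t, (2 * (onProd u₁.1 (ω, t) * onProd (diffusion u₂.1) (ω, t))
      - onProd (diffusion u₂.1) (ω, t) ^ 2) ∂timeMeasure 1 := by
  rw [payoff, sq_abs]
  congr 1
  refine integral_congr_ae (ae_of_all _ fun t => ?_)
  simp only [onProd, diffusion, sq_abs]
  ring

variable [IsProbabilityMeasure P]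

/-- Cauchy-Schwarz against `√t`, whose squared norm is `1/2`. That this constant is below `1` is
what lets Player 2 win the comparison in `exists_le_J`. -/
theorem drift_sq_le (hu : MemLp (onProd u) 2 (spaceTime P 1)) :
    ∀ᵐ ω ∂P, drift u ω ^ 2 ≤ 1 / 2 * ∫ t, onProd u (ω, t) ^ 2 ∂timeMeasure 1 := by
  filter_upwards [hu.integrable_sq.prod_right_ae, hu.1.prodMk_left] with ω h1 h2
  have h3 : MemLp (fun t => onProd u (ω, t)) 2 (timeMeasure 1) :=
    (memLp_two_iff_integrable_sq h2).2 h1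
  have h4 : MemLp (fun t : ℝ≥0 => √(t : ℝ)) 2 (timeMeasure 1) := by
    refine MemLp.of_bound (by fun_prop) 1 ?_
    filter_upwards [ae_timeMeasure_le 1] with t ht using abs_sqrt_coe_le_one t ht
  have h := sq_integral_mul_le h4 h3
  rw [integral_sqrt_sq] at h
  exact h

theorem memLp_drift (hu : MemLp (onProd u) 2 (spaceTime P 1)) : MemLp (drift u) 2 P := by
  have hm := aestronglyMeasurable_drift hu
  refine (memLp_two_iff_integrable_sq hm).2 ?_
  refine Integrable.mono' (hu.integrable_sq.integral_prod_left.const_mul (1 / 2)) (hm.pow 2) ?_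
  filter_upwards [drift_sq_le hu] with ω h
  rw [Real.norm_of_nonneg (sq_nonneg _)]
  exact h

theorem integral_drift_sq_le (hu : MemLp (onProd u) 2 (spaceTime P 1)) :
    ∫ ω, drift u ω ^ 2 ∂P ≤ 1 / 2 * ∫ p, onProd u p ^ 2 ∂spaceTime P 1 := by
  rw [integral_prod _ hu.integrable_sq, ← integral_const_mul]
  exact integral_mono_ae (memLp_drift hu).integrable_sq
    (hu.integrable_sq.integral_prod_left.const_mul _) (drift_sq_le hu)

variable [P.IsComplete] {hW : IsBrownianReal W P} (x : ℝ) (u₁ u₂ : Control hW 1)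

theorem Control.isItoIntegral (u : Control hW 1) {t : ℝ≥0} (ht : t ≤ 1) :
    IsItoIntegral hW (diffusion u.1) t (itoIntegral hW (diffusion u.1) t) :=
  isItoIntegral_itoIntegral ht
    ((isStronglyProgressive_deterministic _ (g := fun t => (t : ℝ)) (by fun_prop)).mul u.2.1)
    u.memLp_diffusion

theorem memLp_noise (u : Control hW 1) : MemLp (noise u) 2 P := (u.isItoIntegral le_rfl).1

theorem integral_noise (u : Control hW 1) : ∫ ω, noise u ω ∂P = 0 :=
  (u.isItoIntegral le_rfl).integral_eq_zero

theorem integral_noise_sq (u : Control hW 1) :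
    ∫ ω, noise u ω ^ 2 ∂P = ∫ p, onProd (diffusion u.1) p ^ 2 ∂spaceTime P 1 :=
  (u.isItoIntegral le_rfl).integral_sq u.memLp_diffusion

theorem memLp_const_add_drift : MemLp (fun ω => x + drift u₁.1 ω) 2 P :=
  (memLp_const x).add (memLp_drift u₁.memLp)

theorem integrable_payoff : Integrable (payoff hW x u₁ u₂) P := by
  rw [funext (payoff_eq x u₁ u₂)]
  exact ((memLp_const_add_drift x u₁).add (memLp_noise u₂)).integrable_sq.add
    (integrable_running u₁ u₂).integral_prod_left

/-- The second moment of the noise cancels the running penalty by the isometry, and `2 x` times the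
noise has mean zero. -/
theorem J_eq : J hW x u₁ u₂ = ∫ ω, (x + drift u₁.1 ω) ^ 2 ∂P
    + 2 * ∫ ω, drift u₁.1 ω * noise u₂ ω ∂P
    + 2 * ∫ p, onProd u₁.1 p * onProd (diffusion u₂.1) p ∂spaceTime P 1 := by
  have hA := memLp_const_add_drift x u₁
  have hM := memLp_noise u₂
  have h1 : ∫ ω, ((x + drift u₁.1 ω) + noise u₂ ω) ^ 2 ∂P = ∫ ω, (x + drift u₁.1 ω) ^ 2 ∂P
      + (2 * ∫ ω, drift u₁.1 ω * noise u₂ ω ∂P + ∫ ω, noise u₂ ω ^ 2 ∂P) := by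
    have i1 := (integrable_fun_mul (memLp_drift u₁.memLp) hM).const_mul 2
    have i2 := (hM.integrable one_le_two).const_mul (2 * x)
    have e : (fun ω => ((x + drift u₁.1 ω) + noise u₂ ω) ^ 2) = fun ω =>
        (x + drift u₁.1 ω) ^ 2 + (2 * (drift u₁.1 ω * noise u₂ ω)
          + (noise u₂ ω ^ 2 + 2 * x * noise u₂ ω)) := by ext ω; ring
    have i3 : Integrable (fun ω => noise u₂ ω ^ 2 + 2 * x * noise u₂ ω) P :=
      hM.integrable_sq.add i2
    have i4 : Integrable (fun ω => 2 * (drift u₁.1 ω * noise u₂ ω)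
        + (noise u₂ ω ^ 2 + 2 * x * noise u₂ ω)) P := i1.add i3
    rw [e, integral_add hA.integrable_sq i4, integral_add i1 i3, integral_add hM.integrable_sq i2,
      integral_const_mul, integral_const_mul, integral_noise, mul_zero, add_zero]
  have i5 : Integrable (fun ω => ((x + drift u₁.1 ω) + noise u₂ ω) ^ 2) P :=
    (hA.add hM).integrable_sq
  have i6 := (integrable_running u₁ u₂).integral_prod_left
  rw [J, integral_congr_ae (ae_of_all _ (payoff_eq x u₁ u₂)), integral_add i5 i6, h1,
    ← integral_prod _ (integrable_running u₁ u₂),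
    integral_sub ((integrable_cross u₁ u₂).const_mul 2) u₂.memLp_diffusion.integrable_sq,
    integral_const_mul, ← integral_noise_sq]
  ring

end Payoff

/-! ### The strategies of the two players and the two values. -/

section Game

variable {Ω : Type*} {mΩ : MeasurableSpace Ω} {P : Measure Ω} {W : ℝ≥0 → Ω → ℝ}
  [P.IsComplete] {hW : IsBrownianReal W P}

/-- The function `1 / t` on `[δ, ∞)`. -/
noncomputable def cutInv (δ t : ℝ≥0) : ℝ := (Ici δ).indicator (fun t : ℝ≥0 => (t : ℝ)⁻¹) t

theorem measurable_cutInv (δ : ℝ≥0) : Measurable (cutInv δ) :=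
  Measurable.indicator (by fun_prop) measurableSet_Ici

theorem cutInv_nonneg (δ t : ℝ≥0) : 0 ≤ cutInv δ t :=
  indicator_nonneg (fun t _ => inv_nonneg.2 t.coe_nonneg) t

theorem cutInv_le {δ : ℝ≥0} (hδ : 0 < δ) (t : ℝ≥0) : cutInv δ t ≤ (δ : ℝ)⁻¹ := by
  have hδ' : (0 : ℝ) < δ := hδ
  refine indicator_le' (fun t ht => ?_) (fun t _ => inv_nonneg.2 δ.coe_nonneg) t
  exact inv_anti₀ hδ' (NNReal.coe_le_coe.2 ht)

theorem mul_cutInv {δ : ℝ≥0} (hδ : 0 < δ) (t : ℝ≥0) :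
    (t : ℝ) * cutInv δ t = (Ici δ).indicator 1 t := by
  by_cases h : t ∈ Ici δ
  · have : (t : ℝ) ≠ 0 := (NNReal.coe_pos.2 (hδ.trans_le h)).ne'
    simp only [cutInv, indicator_of_mem h, Pi.one_apply]
    exact mul_inv_cancel₀ this
  · simp [cutInv, indicator_of_notMem h]

/-- The control `g(t) u(t)` for a deterministic function `g` that is bounded on `[0, 1]`. -/
def Control.weight (u : Control hW 1) {g : ℝ≥0 → ℝ} (hg : Measurable g) {C : ℝ}
    (hC : ∀ t ≤ 1, |g t| ≤ C) : Control hW 1 :=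
  ⟨fun t ω => g t * u.1 t ω, (isStronglyProgressive_deterministic _ hg).mul u.2.1,
    energy_lt_top (memLp_weight hg hC u.memLp)⟩

/-- The control `c u(t) / t` on `[δ, 1]`, zero on `[0, δ)`. -/
noncomputable def Control.response (u : Control hW 1) (c : ℝ) {δ : ℝ≥0} (hδ : 0 < δ) :
    Control hW 1 :=
  u.weight (g := fun t => c * cutInv δ t) ((measurable_cutInv δ).const_mul c)
    (C := |c| * (δ : ℝ)⁻¹) fun t _ => by
      rw [abs_mul, abs_of_nonneg (cutInv_nonneg δ t)]
      exact mul_le_mul_of_nonneg_left (cutInv_le hδ t) (abs_nonneg c)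

theorem diffusion_response (u : Control hW 1) (c : ℝ) {δ : ℝ≥0} (hδ : 0 < δ) (p : Ω × ℝ≥0) :
    onProd (diffusion (u.response c hδ).1) p
      = c * ((Ici δ).indicator 1 p.2 * onProd u.1 p) := by
  rw [← mul_cutInv hδ]
  simp only [onProd, diffusion, Control.response, Control.weight]
  ring

variable [IsProbabilityMeasure P]

/-- The constant control `1`. -/
def Control.one (hW : IsBrownianReal W P) : Control hW 1 :=
  ⟨fun _ _ => 1, isStronglyProgressive_const _ _, energy_lt_top (memLp_const (1 : ℝ))⟩

/-- The zero control. -/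
def Control.zero (hW : IsBrownianReal W P) : Control hW 1 :=
  ⟨fun _ _ => 0, isStronglyProgressive_const _ _, energy_lt_top (memLp_const (0 : ℝ))⟩

variable (x : ℝ) (u₁ u₂ : Control hW 1)

theorem J_zero_left : J hW x (Control.zero hW) u₂ = x ^ 2 := by
  have h : ∀ ω, drift (Control.zero hW).1 ω = 0 := fun ω => by simp [drift, Control.zero]
  rw [J_eq]
  simp only [h]
  simp [onProd, Control.zero]

/-- The noise of the zero control is a chosen version, so it is controlled only through its
vanishing second moment; Cauchy-Schwarz then removes the mixed term. -/
theorem J_zero_right :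
    J hW x u₁ (Control.zero hW) = ∫ ω, (x + drift u₁.1 ω) ^ 2 ∂P := by
  have h0 : ∀ p, onProd (diffusion (Control.zero hW).1) p = 0 := fun p => by
    simp [onProd, diffusion, Control.zero]
  have h := sq_integral_mul_le (memLp_drift u₁.memLp) (memLp_noise (Control.zero hW))
  rw [integral_noise_sq] at h
  simp only [h0] at h
  have h1 : ∫ ω, drift u₁.1 ω * noise (Control.zero hW) ω ∂P = 0 :=
    pow_eq_zero_iff two_ne_zero |>.1 (le_antisymm (by simpa using h) (sq_nonneg _))
  rw [J_eq, h1]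
  simp [h0]

theorem integral_const_add_drift_sq : ∫ ω, (x + drift u₁.1 ω) ^ 2 ∂P
    = x ^ 2 + 2 * x * ∫ ω, drift u₁.1 ω ∂P + ∫ ω, drift u₁.1 ω ^ 2 ∂P := by
  have hA := memLp_drift u₁.memLp
  have i1 : Integrable (fun ω => x ^ 2 + 2 * x * drift u₁.1 ω) P :=
    (integrable_const _).add ((hA.integrable one_le_two).const_mul _)
  have e : (fun ω => (x + drift u₁.1 ω) ^ 2)
      = fun ω => (x ^ 2 + 2 * x * drift u₁.1 ω) + drift u₁.1 ω ^ 2 := by ext ω; ring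
  rw [e, integral_add i1 hA.integrable_sq, integral_add (integrable_const _)
    ((hA.integrable one_le_two).const_mul _), integral_const_mul]
  simp

theorem J_zero_right_of_norm_eq_zero (h : ∫ p, onProd u₁.1 p ^ 2 ∂spaceTime P 1 = 0) :
    J hW x u₁ (Control.zero hW) = x ^ 2 := by
  have hA := memLp_drift u₁.memLp
  have h2 : ∫ ω, drift u₁.1 ω ^ 2 ∂P = 0 :=
    le_antisymm (by simpa [h] using integral_drift_sq_le u₁.memLp)
      (integral_nonneg fun _ => sq_nonneg _)
  have h1 : ∫ ω, drift u₁.1 ω ∂P = 0 := by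
    have := sq_integral_mul_le hA (memLp_const (μ := P) (1 : ℝ))
    simp only [h2, mul_one, zero_mul] at this
    exact pow_eq_zero_iff two_ne_zero |>.1 (le_antisymm this (sq_nonneg _))
  rw [J_zero_right, integral_const_add_drift_sq, h1, h2]
  ring

/-- The response has diffusion `c u₁` on `[δ, 1]`, so the running term is `2 c h` and the noise has
second moment `c² h`. The mixed term is estimated by Cauchy-Schwarz, and the square `(x + A)²` is
dropped. -/
theorem J_response_ge (c : ℝ) (hc : 0 ≤ c) {δ : ℝ≥0} (hδ : 0 < δ) {N h : ℝ}
    (hN : ∫ p, onProd u₁.1 p ^ 2 ∂spaceTime P 1 = N)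
    (hh : ∫ p, (Ici δ).indicator 1 p.2 * onProd u₁.1 p ^ 2 ∂spaceTime P 1 = h) :
    2 * c * (h - √(1 / 2 * N * h)) ≤ J hW x u₁ (u₁.response c hδ) := by
  have e : ∀ p : Ω × ℝ≥0, ((Ici δ).indicator 1 p.2 : ℝ) * (Ici δ).indicator 1 p.2
      = (Ici δ).indicator 1 p.2 := fun p => by
    by_cases hp : p.2 ∈ Ici δ <;> simp [hp, indicator]
  have h0 : 0 ≤ h := by
    rw [← hh]
    exact integral_nonneg fun p => mul_nonneg
      (indicator_nonneg (fun _ _ => zero_le_one) _) (sq_nonneg _)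
  have hN0 : 0 ≤ N := by
    rw [← hN]
    exact integral_nonneg fun p => sq_nonneg _
  have h1 : ∫ p, onProd u₁.1 p * onProd (diffusion (u₁.response c hδ).1) p ∂spaceTime P 1
      = c * h := by
    rw [← hh, ← integral_const_mul]
    congr 1; ext p
    rw [diffusion_response]; ring
  have h2 : ∫ ω, noise (u₁.response c hδ) ω ^ 2 ∂P = c ^ 2 * h := by
    rw [integral_noise_sq, ← hh, ← integral_const_mul]
    congr 1; ext p
    rw [diffusion_response, mul_pow, mul_pow, sq ((Ici δ).indicator 1 p.2), e]
  have h3 := sq_integral_mul_le (memLp_drift u₁.memLp) (memLp_noise (u₁.response c hδ))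
  have h4 : |∫ ω, drift u₁.1 ω * noise (u₁.response c hδ) ω ∂P| ≤ c * √(1 / 2 * N * h) := by
    have hs : c * √(1 / 2 * N * h) = √(c ^ 2 * (1 / 2 * N * h)) := by
      rw [Real.sqrt_mul (sq_nonneg c), Real.sqrt_sq hc]
    rw [hs]
    refine Real.abs_le_sqrt (h3.trans ?_)
    rw [h2]
    have := integral_drift_sq_le u₁.memLp
    rw [hN] at this
    calc _ ≤ 1 / 2 * N * (c ^ 2 * h) := by gcongr
      _ = _ := by ring
  have h5 : 0 ≤ ∫ ω, (x + drift u₁.1 ω) ^ 2 ∂P := integral_nonneg fun _ => sq_nonneg _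
  rw [J_eq, h1]
  linarith [(abs_le.1 h4).1]

theorem exists_le_J : ∃ u₂ : Control hW 1, x ^ 2 ≤ J hW x u₁ u₂ := by
  by_cases hN : ∫ p, onProd u₁.1 p ^ 2 ∂spaceTime P 1 = 0
  · exact ⟨Control.zero hW, (J_zero_right_of_norm_eq_zero x u₁ hN).ge⟩
  obtain ⟨N, hNe⟩ : ∃ N, ∫ p, onProd u₁.1 p ^ 2 ∂spaceTime P 1 = N := ⟨_, rfl⟩
  have hNpos : 0 < N := by
    rw [← hNe]
    exact lt_of_le_of_ne (integral_nonneg fun p => sq_nonneg _) (Ne.symm hN)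
  have hlim := tendsto_integral_cut u₁.memLp.integrable_sq
  rw [hNe] at hlim
  obtain ⟨n, hn⟩ := (hlim.eventually_const_lt (half_lt_self hNpos)).exists
  have hδ : 0 < ((n : ℝ≥0) + 1)⁻¹ := by positivity
  obtain ⟨h, hh⟩ : ∃ h, ∫ p, (Ici ((n : ℝ≥0) + 1)⁻¹).indicator 1 p.2 * onProd u₁.1 p ^ 2
    ∂spaceTime P 1 = h := ⟨_, rfl⟩
  rw [hh] at hn
  -- From `h > N / 2` follows `N h / 2 < h²`.
  have hpos : 0 < h - √(1 / 2 * N * h) := by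
    rw [sub_pos, Real.sqrt_lt' (by linarith)]
    nlinarith
  -- This `c` makes the lower bound equal to `x²`.
  refine ⟨u₁.response (x ^ 2 / (2 * (h - √(1 / 2 * N * h)))) hδ, le_trans (le_of_eq ?_)
    (J_response_ge x u₁ _ (by positivity) hδ hNe hh)⟩
  have := hpos.ne'
  generalize h - √(1 / 2 * N * h) = d at this
  field_simp

theorem upperValue_eq : upperValue hW x = ((x ^ 2 : ℝ) : EReal) := by
  refine le_antisymm (iInf_le_of_le (Control.zero hW) (iSup_le fun u₂ => ?_))
    (le_iInf fun u₁ => ?_)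
  · rw [J_zero_left]
  · obtain ⟨u₂, h⟩ := exists_le_J x u₁
    exact le_iSup_of_le u₂ (EReal.coe_le_coe_iff.2 h)

/-- The time `exp (-n)`. -/
noncomputable def expTime (n : ℕ) : ℝ≥0 := ⟨Real.exp (-n), (Real.exp_pos _).le⟩

theorem expTime_pos (n : ℕ) : 0 < expTime n := Real.exp_pos _

theorem integral_cutInv (n : ℕ) : ∫ t, cutInv (expTime n) t ∂timeMeasure 1 = n := by
  have hp : 0 < Real.exp (-n) := Real.exp_pos _
  have hle : Real.exp (-n) ≤ 1 := Real.exp_le_one_iff.2 (by simp)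
  have h1 : ∫ t, cutInv (expTime n) t ∂timeMeasure 1
      = ∫ t in Icc (expTime n) 1, (t : ℝ)⁻¹ ∂lebesgue := by
    unfold cutInv
    rw [integral_indicator measurableSet_Ici, Measure.restrict_restrict measurableSet_Ici]
    congr 2
    ext t; simp
  rw [h1, setIntegral_lebesgue_Icc (fun t => t⁻¹), integral_Icc_eq_integral_Ioc,
    ← intervalIntegral.integral_of_le (by exact hle)]
  change ∫ t in Real.exp (-n)..1, t⁻¹ = n
  rw [integral_inv_of_pos hp one_pos, one_div, ← Real.exp_neg, neg_neg, Real.log_exp]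

/-- The deterministic control `-(x / n) t ^ (-3 / 2)` on `[exp (-n), 1]`. -/
noncomputable def Control.cancel (hW : IsBrownianReal W P) (x : ℝ) (n : ℕ) : Control hW 1 :=
  (Control.one hW).weight
    (g := fun t => -(x / n) * (cutInv (expTime n) t * √(cutInv (expTime n) t)))
    (((measurable_cutInv _).mul (measurable_cutInv _).sqrt).const_mul _)
    (C := |-(x / n)| * ((expTime n : ℝ)⁻¹ * √((expTime n : ℝ)⁻¹))) fun t _ => by
      have h := cutInv_le (expTime_pos n) t
      have h0 := cutInv_nonneg (expTime n) t
      rw [abs_mul, abs_of_nonneg (mul_nonneg h0 (Real.sqrt_nonneg _))]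
      gcongr

theorem mul_cutInv_mul_cutInv {δ : ℝ≥0} (hδ : 0 < δ) (t : ℝ≥0) :
    (t : ℝ) * cutInv δ t * cutInv δ t = cutInv δ t := by
  rw [mul_cutInv hδ, cutInv]
  by_cases h : t ∈ Ici δ <;> simp [h, indicator]

theorem drift_cancel (x : ℝ) {n : ℕ} (hn : 0 < n) (ω : Ω) :
    drift (Control.cancel hW x n).1 ω = -x := by
  have hn' : (n : ℝ) ≠ 0 := Nat.cast_ne_zero.2 hn.ne'
  have e : ∀ t : ℝ≥0, √(t : ℝ) * (Control.cancel hW x n).1 t ω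
      = -(x / n) * cutInv (expTime n) t := fun t => by
    have h : √(t : ℝ) * √(cutInv (expTime n) t) * cutInv (expTime n) t
        = cutInv (expTime n) t := by
      rw [← Real.sqrt_mul t.coe_nonneg, mul_cutInv (expTime_pos n), cutInv]
      by_cases h : t ∈ Ici (expTime n) <;> simp [h, indicator]
    simp only [Control.cancel, Control.weight, Control.one]
    linear_combination -(x / n) * h
  rw [drift]
  simp_rw [e]
  rw [integral_const_mul, integral_cutInv]
  field_simp

/-- The square of `t · t^(-3/2)` is `1 / t`, with integral `n`, against the prefactor `(x / n)²`. -/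
theorem integral_mul_cancel_sq (x : ℝ) {n : ℕ} (hn : 0 < n) :
    ∫ p : Ω × ℝ≥0, ((p.2 : ℝ) * onProd (Control.cancel hW x n).1 p) ^ 2 ∂spaceTime P 1
      = x ^ 2 / n := by
  have hn' : (n : ℝ) ≠ 0 := Nat.cast_ne_zero.2 hn.ne'
  have e : ∀ p : Ω × ℝ≥0, ((p.2 : ℝ) * onProd (Control.cancel hW x n).1 p) ^ 2
      = (x / n) ^ 2 * cutInv (expTime n) p.2 := fun p => by
    have h1 := mul_cutInv_mul_cutInv (expTime_pos n) p.2
    have h2 := Real.sq_sqrt (cutInv_nonneg (expTime n) p.2)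
    simp only [onProd, Control.cancel, Control.weight, Control.one]
    calc _ = (x / n) ^ 2 * ((p.2 : ℝ) * cutInv (expTime n) p.2) ^ 2
            * √(cutInv (expTime n) p.2) ^ 2 := by ring
      _ = (x / n) ^ 2 * ((p.2 : ℝ) * (p.2 * cutInv (expTime n) p.2 * cutInv (expTime n) p.2)
            * cutInv (expTime n) p.2) := by rw [h2]; ring
      _ = _ := by rw [h1, h1]
  simp_rw [e]
  rw [integral_const_mul, integral_fun_snd, integral_cutInv]
  simp
  field_simp

/-- The drift is the constant `-x`, which kills the first term of `J_eq` and, the noise being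
centred, the second. In the last term `t` is moved onto `u₁` before Cauchy-Schwarz, since only `t
u₁` is small. -/
theorem J_cancel_sq_le {n : ℕ} (hn : 0 < n) : J hW x (Control.cancel hW x n) u₂ ^ 2
    ≤ 4 * (x ^ 2 * ∫ p, onProd u₂.1 p ^ 2 ∂spaceTime P 1) / n := by
  have h1 := sq_integral_mul_le (memLp_weight (g := fun t => (t : ℝ)) (by fun_prop) abs_coe_le_one
    (Control.cancel hW x n).memLp) u₂.memLp
  rw [integral_mul_cancel_sq x hn] at h1
  have h2 : ∫ p, onProd (Control.cancel hW x n).1 p * onProd (diffusion u₂.1) p ∂spaceTime P 1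
      = ∫ p : Ω × ℝ≥0, (p.2 : ℝ) * onProd (Control.cancel hW x n).1 p * onProd u₂.1 p
        ∂spaceTime P 1 := by
    congr 1; ext p
    simp only [onProd, diffusion]
    ring
  rw [J_eq]
  simp only [drift_cancel x hn]
  rw [integral_const_mul, integral_noise, h2]
  simp only [add_neg_cancel, ne_eq, OfNat.ofNat_ne_zero, not_false_eq_true, zero_pow,
    integral_zero, mul_zero, zero_add, mul_pow]
  calc _ ≤ 2 ^ 2 * (x ^ 2 / n * ∫ p, onProd u₂.1 p ^ 2 ∂spaceTime P 1) := by gcongr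
    _ = _ := by ring

theorem tendsto_J_cancel :
    Tendsto (fun n : ℕ => J hW x (Control.cancel hW x (n + 1)) u₂) atTop (𝓝 0) := by
  have h1 : Tendsto (fun n : ℕ => J hW x (Control.cancel hW x (n + 1)) u₂ ^ 2) atTop (𝓝 0) := by
    refine tendsto_of_tendsto_of_tendsto_of_le_of_le tendsto_const_nhds
      ((tendsto_add_atTop_iff_nat 1).2 (tendsto_const_div_atTop_nhds_zero_nat
        (4 * (x ^ 2 * ∫ p, onProd u₂.1 p ^ 2 ∂spaceTime P 1))))
      (fun n => sq_nonneg _) (fun n => J_cancel_sq_le x u₂ n.succ_pos)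
  have h2 := h1.sqrt
  simp only [Real.sqrt_sq_eq_abs, Real.sqrt_zero] at h2
  exact tendsto_zero_iff_abs_tendsto_zero _ |>.2 h2

theorem lowerValue_eq : lowerValue hW x = 0 := by
  refine le_antisymm (iSup_le fun u₂ => ?_)
    (le_iSup_of_le (Control.zero hW) (le_iInf fun u₁ => ?_))
  · have h := (continuous_coe_real_ereal.tendsto 0).comp (tendsto_J_cancel x u₂)
    exact ge_of_tendsto' h fun n => iInf_le _ _
  · rw [J_zero_right]
    exact EReal.coe_nonneg.2 (integral_nonneg fun _ => sq_nonneg _)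

end Game

end LQGame

theorem mainTheorem10 {Ω : Type*} {mΩ : MeasurableSpace Ω} (P : Measure Ω)
    [IsProbabilityMeasure P] [P.IsComplete] (W : ℝ≥0 → Ω → ℝ) (hW : IsBrownianReal W P) :
    (∀ (x : ℝ) (u₁ u₂ : LQGame.Control hW 1),
      (∀ t : ℝ≥0, t ≤ 1 → LQGame.IsItoIntegral hW (fun s ω => (s : ℝ) * u₂.1 s ω) t
        (LQGame.itoIntegral hW (fun s ω => (s : ℝ) * u₂.1 s ω) t)) ∧
      Integrable (LQGame.payoff hW x u₁ u₂) P) ∧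
    (∀ x : ℝ, LQGame.upperValue hW x = ((x ^ 2 : ℝ) : EReal) ∧ LQGame.lowerValue hW x = 0) ∧
    (∀ x : ℝ, x ≠ 0 → ¬ LQGame.HasOpenLoopValue hW x) := by
  refine ⟨fun x u₁ u₂ => ⟨fun t ht => u₂.isItoIntegral ht, LQGame.integrable_payoff x u₁ u₂⟩,
    fun x => ⟨LQGame.upperValue_eq x, LQGame.lowerValue_eq x⟩, fun x hx h => ?_⟩
  rw [LQGame.HasOpenLoopValue, LQGame.lowerValue_eq, LQGame.upperValue_eq] at h
  exact pow_ne_zero 2 hx (EReal.coe_eq_zero.1 h.symm)
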